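/- **Setting.** Let $(\Omega,\mathcal F)$ be a measurable space and $\mathcal H$ a set of real random variables on it such that $I_A\in\mathcal H$ for all $A\in\mathcal F$, and $\varphi(X_1,\dots,X_n)\in\mathcal H$ whenever $X_1,\dots,X_n\in\mathcal H$ and $\varphi:\mathbb R^n\to\mathbb R$ satisfies $|\varphi(x)-\varphi(y)|\le C(1+|x|^m+|y|^m)|x-y|$ for all $x,y\in\mathbb R^n$ and some $C>0$, $m\in\mathbb N$. Let $\mathbb E:\mathcal H\to[-\infty,\infty]$ be a sublinear expectation: it is monotone, $\mathbb E[c]=c$ for $c\in\mathbb R$, $\mathbb E[\lambda X]=\lambda\mathbb E[X]$ for $\lambda\ge 0$, and $\mathbb E[X+Y]\le\mathbb E[X]+\mathbb E[Y]$ whenever the right side is not of the form $\infty-\infty$ or $-\infty+\infty$. Assume that $\mathbb E$ is countably sub-additive: $\mathbb E[X]\le\sum_{n\ge1}\mathbb E[X_n]$ whenever $X\le\sum_{n\ge 1}X_n$ with $0\le X\in\mathcal H$ and $0\le X_n\in\mathcal H$. Put $\mathbb V(A)=\inf\{\mathbb E[\xi]: I_A\le\xi,\ \xi\in\mathcal H\}$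 for $A\in\mathcal F$ and $$C_{\mathbb V}(X)=\int_0^\infty\mathbb V(X>x)\,dx+\int_{-\infty}^0(\mathbb V(X>x)-1)\,dx .$$ A random vector $\mathbf Y$ with components in $\mathcal H$ is *independent of* such a random vector $\mathbf X$ if for each Borel function $\psi$ with $\psi(\mathbf X,\mathbf Y)\in\mathcal H$ and $\psi(\mathbf x,\mathbf Y)\in\mathcal H$ for all $\mathbf x$, we have $\mathbb E[\psi(\mathbf X,\mathbf Y)]=\mathbb E\big[\mathbb E[\psi(\mathbf x,\mathbf Y)]|_{\mathbf x=\mathbf X}\big]$ whenever $\bar\psi(\mathbf x):=\mathbb E|\psi(\mathbf x,\mathbf Y)|<\infty$ for all $\mathbf x$ and $\mathbb E|\bar\psi(\mathbf X)|<\infty$ (the identity being required only when $\bar\psi(\mathbf X)$ and $\mathbb E[\psi(\mathbf x,\mathbf Y)]|_{\mathbf x=\mathbf X}$ belong to $\mathcal H$). A sequence $X_1,X_2,\dots$ is *independent* if $X_{n+1}$ is independent of $(X_1,\dots,X_n)$ for each $n\ge1$. Variables $X,X'\in\mathcal H$ are *identically distributed* if $\mathbb E[\psi(X)]=\mathbb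 E[\psi(X')]$ for each Borel $\psi$ with $\psi(X),\psi(X')\in\mathcal H$ for which both expectations are finite. **Theorem 3.1.** Let $X\in\mathcal H$, and let $X_1,X_2,\dots\in\mathcal H$ be an independent sequence, each $X_n$ being identically distributed with $X$. Let $r>1$, $p>\frac12$, $\beta+p>0$, and, if $\frac12<p\le1$, suppose that $\mathbb E[X]=-\mathbb E[-X]=0$. Let $\{a_{ni}:1\le i\le n,\ n\ge1\}$ be real numbers with $a_{ni}\approx(i/n)^\beta(1/n)^p$, that is, there are $C>0$ and $N$ such that $C^{-1}(i/n)^\beta n^{-p}\le a_{ni}\le C(i/n)^\beta n^{-p}$ for all $n\ge N$ and $1\le i\le n$. Then the following are equivalent: (i) $$\begin{cases}C_{\mathbb V}\big(|X|^{(r-1)/(p+\beta)}\big)<\infty, & \text{if } -p<\beta<-p/r,\\ C_{\mathbb V}\big(|X|^{r/p}\ln(1+|X|)\big)<\infty, & \text{if } \beta=-p/r,\\ C_{\mathbb V}\big(|X|^{r/p}\big)<\infty, & \text{if } \beta>-p/r;\end{cases}$$ (ii) $$\sum_{n=1}^\infty n^{r-2}\,\mathbb V\Big(\max_{1\le j\le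 n}\Big|\sum_{i=1}^j a_{ni}X_i\Big|>\epsilon\Big)<\infty\quad\text{for all }\epsilon>0 .$$ -/

import Mathlib

open MeasureTheory
open scoped ENNReal

/-- The class `C_{l,Lip}(ℝ^d)` of locally Lipschitz functions of polynomial growth. (All norms on
`ℝ^d` give the same class; the supremum norm of `Fin d → ℝ` is used here.) -/
def IsLocLip {d : ℕ} (φ : (Fin d → ℝ) → ℝ) : Prop :=
  ∃ C : ℝ, 0 < C ∧ ∃ m : ℕ, ∀ x y : Fin d → ℝ,
    |φ x - φ y| ≤ C * (1 + ‖x‖ ^ m + ‖y‖ ^ m) * ‖x - y‖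

/-- A sublinear expectation space `(Ω, H, E)` over the measurable space `Ω`. The expectation is
a functional on `H`: its values at functions outside `H` are unconstrained, and no definition
below makes use of them. -/
structure SublinearExpectationSpace (Ω : Type*) [MeasurableSpace Ω] where
  /-- the set of random variables on which the expectation is defined -/
  H : Set (Ω → ℝ)
  measurable_of_mem : ∀ X ∈ H, Measurable X
  indicator_mem : ∀ A : Set Ω, MeasurableSet A → A.indicator (fun _ => (1 : ℝ)) ∈ H
  comp_mem : ∀ (d : ℕ) (X : Fin d → Ω → ℝ) (φ : (Fin d → ℝ) → ℝ),
    (∀ i, X i ∈ H) → IsLocLip φ → (fun ω => φ (fun i => X i ω)) ∈ H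
  /-- the sublinear expectation -/
  E : (Ω → ℝ) → EReal
  mono : ∀ X ∈ H, ∀ Y ∈ H, (∀ ω, Y ω ≤ X ω) → E Y ≤ E X
  const : ∀ c : ℝ, E (fun _ => c) = (c : EReal)
  pos_homogeneous : ∀ X ∈ H, ∀ l : ℝ, 0 ≤ l → E (fun ω => l * X ω) = (l : EReal) * E X
  subadditive : ∀ X ∈ H, ∀ Y ∈ H, ¬(E X = ⊤ ∧ E Y = ⊥) → ¬(E X = ⊥ ∧ E Y = ⊤) →
    E (fun ω => X ω + Y ω) ≤ E X + E Y

namespace SublinearExpectationSpace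

variable {Ω : Type*} [MeasurableSpace Ω]

/-- Countable sub-additivity: `E X ≤ ∑ E Xₙ` whenever `X ≤ ∑ Xₙ` pointwise, all variables being
nonnegative elements of `H`. Both series are series of nonnegative terms and may be infinite. -/
def CountablySubadditive (S : SublinearExpectationSpace Ω) : Prop :=
  ∀ (X : Ω → ℝ) (Y : ℕ → Ω → ℝ), X ∈ S.H → (∀ n, Y n ∈ S.H) →
    (∀ ω, 0 ≤ X ω) → (∀ n ω, 0 ≤ Y n ω) →
    (∀ ω, ENNReal.ofReal (X ω) ≤ ∑' n, ENNReal.ofReal (Y n ω)) →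
    S.E X ≤ ((∑' n, (S.E (Y n)).toENNReal : ℝ≥0∞) : EReal)

/-- The capacity `V(A) = inf {E ξ : I_A ≤ ξ, ξ ∈ H}`. The infimum lies in `[0, 1]`, so nothing
is lost in regarding it as an element of `[0, ∞]`. -/
noncomputable def capacity (S : SublinearExpectationSpace Ω) (A : Set Ω) : ℝ≥0∞ :=
  (sInf {e : EReal | ∃ ξ ∈ S.H,
    (∀ ω, A.indicator (fun _ => (1 : ℝ)) ω ≤ ξ ω) ∧ e = S.E ξ}).toENNReal

/-- The Choquet expectation
`C_V(X) = ∫_0^∞ V(X > x) dx + ∫_{-∞}^0 (V(X > x) - 1) dx`, as an extended real number. -/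
noncomputable def choquet (S : SublinearExpectationSpace Ω) (X : Ω → ℝ) : EReal :=
  ((∫⁻ x in Set.Ioi (0 : ℝ), S.capacity {ω | x < X ω} : ℝ≥0∞) : EReal)
    - ((∫⁻ x in Set.Iio (0 : ℝ), (1 - S.capacity {ω | x < X ω}) : ℝ≥0∞) : EReal)

/-- The random vector `Y` is independent of the random vector `X`: for every Borel function `ψ`
with `ψ(X, Y), ψ(x, Y) ∈ H` for all `x`, `E ψ(X, Y) = E [ (E ψ(x, Y))|_{x = X} ]` whenever
`ψ'(x) = E |ψ(x, Y)| < ∞` for all `x` and `E |ψ'(X)| < ∞`. Since `E` is a functional on `H`, the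
latter two expectations are meaningful only if the variables in question belong to `H`. -/
def IndepOf (S : SublinearExpectationSpace Ω) {m n : ℕ}
    (Y : Fin n → Ω → ℝ) (X : Fin m → Ω → ℝ) : Prop :=
  ∀ ψ : (Fin m → ℝ) × (Fin n → ℝ) → ℝ, Measurable ψ →
    (fun ω => ψ (fun i => X i ω, fun j => Y j ω)) ∈ S.H →
    (∀ x : Fin m → ℝ, (fun ω => ψ (x, fun j => Y j ω)) ∈ S.H) →
    (∀ x : Fin m → ℝ, S.E (fun ω => |ψ (x, fun j => Y j ω)|) < ⊤) →
    (fun ω => (S.E (fun ω' => |ψ (fun i => X i ω, fun j => Y j ω')|)).toReal) ∈ S.H →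
    S.E (fun ω => |(S.E (fun ω' => |ψ (fun i => X i ω, fun j => Y j ω')|)).toReal|) < ⊤ →
    (fun ω => (S.E (fun ω' => ψ (fun i => X i ω, fun j => Y j ω'))).toReal) ∈ S.H →
    S.E (fun ω => ψ (fun i => X i ω, fun j => Y j ω)) =
      S.E (fun ω => (S.E (fun ω' => ψ (fun i => X i ω, fun j => Y j ω'))).toReal)

/-- The sequence `X 1, X 2, …` is independent: `X (n + 1)` is independent of `(X 1, …, X n)` for
each `n ≥ 1`. (The entry `X 0` plays no role.) -/
def IndepSeq (S : SublinearExpectationSpace Ω) (X : ℕ → Ω → ℝ) : Prop :=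
  ∀ n : ℕ, 1 ≤ n →
    S.IndepOf (fun _ : Fin 1 => X (n + 1)) (fun i : Fin n => X ((i : ℕ) + 1))

/-- Random vectors on two sublinear expectation spaces are identically distributed: for every
Borel function `ψ` such that `ψ(X₁) ∈ H₁` and `ψ(X₂) ∈ H₂`, one has `E₁ ψ(X₁) = E₂ ψ(X₂)` whenever
these are finite. -/
def IdentDistributed {Ω₁ Ω₂ : Type*} [MeasurableSpace Ω₁] [MeasurableSpace Ω₂]
    (S₁ : SublinearExpectationSpace Ω₁) (S₂ : SublinearExpectationSpace Ω₂) {d : ℕ}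
    (X₁ : Fin d → Ω₁ → ℝ) (X₂ : Fin d → Ω₂ → ℝ) : Prop :=
  ∀ ψ : (Fin d → ℝ) → ℝ, Measurable ψ →
    (fun ω => ψ (fun i => X₁ i ω)) ∈ S₁.H → (fun ω => ψ (fun i => X₂ i ω)) ∈ S₂.H →
    S₁.E (fun ω => ψ (fun i => X₁ i ω)) ≠ ⊤ → S₁.E (fun ω => ψ (fun i => X₁ i ω)) ≠ ⊥ →
    S₂.E (fun ω => ψ (fun i => X₂ i ω)) ≠ ⊤ → S₂.E (fun ω => ψ (fun i => X₂ i ω)) ≠ ⊥ →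
    S₁.E (fun ω => ψ (fun i => X₁ i ω)) = S₂.E (fun ω => ψ (fun i => X₂ i ω))

end SublinearExpectationSpace

/-- `a_{ni} ≪ b_{ni}` for triangular arrays indexed by `1 ≤ i ≤ n`: there is a constant `C > 0`
such that `a_{ni} ≤ C b_{ni}` for all `n` large enough and all `1 ≤ i ≤ n`. -/
def ArrayLL (a b : ℕ → ℕ → ℝ) : Prop :=
  ∃ C : ℝ, 0 < C ∧ ∃ N : ℕ, ∀ n, N ≤ n → ∀ i, 1 ≤ i → i ≤ n → a n i ≤ C * b n i

/-- `a_{ni} ≈ b_{ni}`: both `a_{ni} ≪ b_{ni}` and `b_{ni} ≪ a_{ni}`. -/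
def ArrayApprox (a b : ℕ → ℕ → ℝ) : Prop :=
  ArrayLL a b ∧ ArrayLL b a

/-- `max_{1 ≤ j ≤ n} |∑_{i=1}^j a_{ni} X_i(ω)|`. -/
noncomputable def maxWeightedSum {Ω : Type*} (a : ℕ → ℕ → ℝ) (X : ℕ → Ω → ℝ) (n : ℕ+) (ω : Ω) :
    ℝ :=
  (Finset.Icc 1 (n : ℕ)).sup' (Finset.nonempty_Icc.2 (Nat.succ_le_of_lt n.pos))
    (fun j => |∑ i ∈ Finset.Icc 1 j, a n i * X i ω|)

/-!
Write `J n i = n ^ (p + β) * i ^ (-β)`, so that the weights `a n i` are comparable to `(J n i)⁻¹`.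
Both conditions are equivalent to the finiteness of the tail series
`∑ n, n ^ (r - 2) * ∑ i ≤ n, V(|X| > c * J n i)`.

For (i), put the mass `n ^ (r - 2)` at each level `J n i`, `i ≤ n`. The mass below `T` is comparable
to the function of `T` whose Choquet moment enters (i), and the layer-cake formula turns the tail
series into that moment.

From the series to (ii), off the event that some `|X_i|` exceeds `c * J n i` the partial sums are
sums of truncated variables. Since `V(|X| > t)` decays like `t ^ (-q)` for some `q < 2` with
`1 < p * q`, an exponential maximal inequality with parameter of order `log n` bounds the
capacity that one of them is large by a multiple of `n ^ (-r)`, which is summable against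
`n ^ (r - 2)`.

From (ii) to the series, a big weighted term forces a big partial sum. Hence the capacity that
some `|X_i|` exceeds `c * J n i` is summable against `n ^ (r - 2)`, and therefore tends to `0`, as
the event at `n` is contained in the corresponding events for all `m` between `n` and `2 * n`. By
independence this capacity is `1 - ∏ i ≤ n, (1 - V(|X| > c * J n i))`, which is at least half of
`∑ i ≤ n, V(|X| > c * J n i)` once it is below `1 / 2`.
-/

/-! ### Sublinear expectations and capacities -/

theorem IsLocLip.of_abs_sub_le {d : ℕ} {φ : (Fin d → ℝ) → ℝ} (C : ℝ)
    (h : ∀ x y, |φ x - φ y| ≤ C * ‖x - y‖) : IsLocLip φ := by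
  refine ⟨|C| + 1, by positivity, 0, fun x y => (h x y).trans ?_⟩
  simp only [pow_zero]
  gcongr
  linarith [le_abs_self C, abs_nonneg C]

namespace SublinearExpectationSpace

variable {Ω : Type*} [MeasurableSpace Ω] {S : SublinearExpectationSpace Ω} {X Y : Ω → ℝ}

section Membership

theorem const_mem (c : ℝ) : (fun _ : Ω => c) ∈ S.H :=
  S.comp_mem 0 (fun i => i.elim0) (fun _ => c) (fun i => i.elim0)
    (IsLocLip.of_abs_sub_le 0 (by simp))

theorem comp_mem_of_abs_sub_le (hX : X ∈ S.H) {φ : ℝ → ℝ} (C : ℝ)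
    (hφ : ∀ x y, |φ x - φ y| ≤ C * |x - y|) : (fun ω => φ (X ω)) ∈ S.H := by
  refine S.comp_mem 1 (fun _ => X) (fun x => φ (x 0)) (fun _ => hX)
    (IsLocLip.of_abs_sub_le |C| fun x y => (hφ _ _).trans ?_)
  have h : |x 0 - y 0| ≤ ‖x - y‖ := norm_le_pi_norm (x - y) 0
  gcongr
  exact le_abs_self C

theorem add_mem (hX : X ∈ S.H) (hY : Y ∈ S.H) : (fun ω => X ω + Y ω) ∈ S.H := by
  have h := S.comp_mem 2 ![X, Y] (fun x => x 0 + x 1)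
    (by intro i; fin_cases i <;> simpa) (IsLocLip.of_abs_sub_le 2 fun x y => ?_)
  · simpa using h
  · have h0 : |x 0 - y 0| ≤ ‖x - y‖ := norm_le_pi_norm (x - y) 0
    have h1 : |x 1 - y 1| ≤ ‖x - y‖ := norm_le_pi_norm (x - y) 1
    rw [add_sub_add_comm]
    linarith [abs_add_le (x 0 - y 0) (x 1 - y 1)]

theorem mul_mem (hX : X ∈ S.H) (hY : Y ∈ S.H) : (fun ω => X ω * Y ω) ∈ S.H := by
  have h := S.comp_mem 2 ![X, Y] (fun x => x 0 * x 1)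
    (by intro i; fin_cases i <;> simpa) ⟨1, one_pos, 1, fun x y => ?_⟩
  · simpa using h
  · have h0 : |x 0 - y 0| ≤ ‖x - y‖ := norm_le_pi_norm (x - y) 0
    have h1 : |x 1 - y 1| ≤ ‖x - y‖ := norm_le_pi_norm (x - y) 1
    have h2 : |x 1| ≤ ‖x‖ := norm_le_pi_norm x 1
    have h3 : |y 0| ≤ ‖y‖ := norm_le_pi_norm y 0
    calc |x 0 * x 1 - y 0 * y 1| = |(x 0 - y 0) * x 1 + y 0 * (x 1 - y 1)| := by ring_nf
      _ ≤ |x 0 - y 0| * |x 1| + |y 0| * |x 1 - y 1| := by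
          rw [← abs_mul, ← abs_mul]; exact abs_add_le _ _
      _ ≤ ‖x - y‖ * ‖x‖ + ‖y‖ * ‖x - y‖ := by gcongr
      _ ≤ 1 * (1 + ‖x‖ ^ 1 + ‖y‖ ^ 1) * ‖x - y‖ := by nlinarith [norm_nonneg (x - y)]

theorem const_mul_mem (hX : X ∈ S.H) (c : ℝ) : (fun ω => c * X ω) ∈ S.H :=
  mul_mem (const_mem c) hX

theorem abs_mem (hX : X ∈ S.H) : (fun ω => |X ω|) ∈ S.H :=
  comp_mem_of_abs_sub_le hX 1 fun x y => by simpa using abs_abs_sub_abs_le x y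

theorem min_const_mem (hX : X ∈ S.H) (c : ℝ) : (fun ω => min (X ω) c) ∈ S.H :=
  comp_mem_of_abs_sub_le hX (φ := fun x => min x c) 1
    fun x y => by simpa using abs_min_sub_min_le_max x c y c

theorem max_const_mem (hX : X ∈ S.H) (c : ℝ) : (fun ω => max (X ω) c) ∈ S.H :=
  comp_mem_of_abs_sub_le hX (φ := fun x => max x c) 1
    fun x y => by simpa using abs_max_sub_max_le_max x c y c

end Membership

/-- The random variable `X` belongs to the domain of the expectation and is bounded. On such
variables the expectation is finite and therefore a sublinear functional in the usual sense. -/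
def IsBdd (S : SublinearExpectationSpace Ω) (X : Ω → ℝ) : Prop :=
  X ∈ S.H ∧ ∃ C : ℝ, ∀ ω, |X ω| ≤ C

/-- The sublinear expectation as a real number, used for bounded random variables; it has the junk
value `0` where `E` is infinite. -/
noncomputable def expect (S : SublinearExpectationSpace Ω) (X : Ω → ℝ) : ℝ := (S.E X).toReal

/-- The capacity of an event as a real number (the analogue of `Measure.real`). -/
noncomputable def capacityReal (S : SublinearExpectationSpace Ω) (A : Set Ω) : ℝ :=
  (S.capacity A).toReal

namespace IsBdd

theorem const (c : ℝ) : S.IsBdd (fun _ => c) := ⟨const_mem c, |c|, fun _ => le_rfl⟩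

theorem add (hX : S.IsBdd X) (hY : S.IsBdd Y) : S.IsBdd (fun ω => X ω + Y ω) := by
  obtain ⟨hX, C, hC⟩ := hX
  obtain ⟨hY, D, hD⟩ := hY
  exact ⟨add_mem hX hY, C + D, fun ω => (abs_add_le _ _).trans (add_le_add (hC ω) (hD ω))⟩

theorem mul (hX : S.IsBdd X) (hY : S.IsBdd Y) : S.IsBdd (fun ω => X ω * Y ω) := by
  obtain ⟨hX, C, hC⟩ := hX
  obtain ⟨hY, D, hD⟩ := hY
  refine ⟨mul_mem hX hY, C * D, fun ω => ?_⟩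
  rw [abs_mul]
  exact mul_le_mul (hC ω) (hD ω) (abs_nonneg _) ((abs_nonneg _).trans (hC ω))

theorem const_mul (hX : S.IsBdd X) (c : ℝ) : S.IsBdd (fun ω => c * X ω) :=
  (IsBdd.const c).mul hX

theorem neg (hX : S.IsBdd X) : S.IsBdd (fun ω => -X ω) := by simpa using hX.const_mul (-1)

theorem abs (hX : S.IsBdd X) : S.IsBdd (fun ω => |X ω|) := by
  obtain ⟨hX, C, hC⟩ := hX
  exact ⟨abs_mem hX, C, fun ω => by simpa using hC ω⟩

theorem prod {ι : Type*} (s : Finset ι) {Y : ι → Ω → ℝ} (hY : ∀ i ∈ s, S.IsBdd (Y i)) :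
    S.IsBdd (fun ω => ∏ i ∈ s, Y i ω) := by
  classical
  induction s using Finset.induction_on with
  | empty => simpa only [Finset.prod_empty] using const 1
  | insert i s hi ih =>
    simp only [Finset.prod_insert hi]
    exact (hY i (Finset.mem_insert_self i s)).mul
      (ih fun j hj => hY j (Finset.mem_insert_of_mem hj))

theorem indicator {A : Set Ω} (hA : MeasurableSet A) : S.IsBdd (A.indicator fun _ => (1 : ℝ)) :=
  ⟨S.indicator_mem A hA, 1, fun ω => by by_cases h : ω ∈ A <;> simp [h]⟩

theorem coe_expect (hX : S.IsBdd X) : (S.expect X : EReal) = S.E X := by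
  obtain ⟨hX, C, hC⟩ := hX
  refine EReal.coe_toReal (fun h => ?_) (fun h => ?_)
  · have := S.mono _ (const_mem C) _ hX (fun ω => (abs_le.1 (hC ω)).2)
    rw [h, S.const] at this
    exact EReal.coe_ne_top C (top_le_iff.1 this)
  · have := S.mono _ hX _ (const_mem (-C)) (fun ω => (abs_le.1 (hC ω)).1)
    rw [h, S.const] at this
    exact EReal.coe_ne_bot (-C) (le_bot_iff.1 this)

end IsBdd

section Expect

theorem expect_const (c : ℝ) : S.expect (fun _ => c) = c := by simp [expect, S.const]

theorem expect_mono (hX : S.IsBdd X) (hY : S.IsBdd Y) (h : ∀ ω, X ω ≤ Y ω) :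
    S.expect X ≤ S.expect Y := by
  have := S.mono _ hY.1 _ hX.1 h
  rwa [← hX.coe_expect, ← hY.coe_expect, EReal.coe_le_coe_iff] at this

theorem expect_add_le (hX : S.IsBdd X) (hY : S.IsBdd Y) :
    S.expect (fun ω => X ω + Y ω) ≤ S.expect X + S.expect Y := by
  have := S.subadditive _ hX.1 _ hY.1 (by simp [← hX.coe_expect]) (by simp [← hX.coe_expect])
  rw [← hX.coe_expect, ← hY.coe_expect, ← (hX.add hY).coe_expect] at this
  exact_mod_cast this

theorem expect_const_mul (hX : S.IsBdd X) {l : ℝ} (hl : 0 ≤ l) :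
    S.expect (fun ω => l * X ω) = l * S.expect X := by
  have := S.pos_homogeneous _ hX.1 l hl
  rw [← hX.coe_expect, ← (hX.const_mul l).coe_expect] at this
  exact_mod_cast this

theorem expect_const_add (hX : S.IsBdd X) (c : ℝ) :
    S.expect (fun ω => c + X ω) = c + S.expect X := by
  apply le_antisymm
  · simpa only [expect_const] using expect_add_le (IsBdd.const c) hX
  · have := expect_add_le (IsBdd.const (-c)) ((IsBdd.const c).add hX)
    simp only [neg_add_cancel_left, expect_const] at this
    linarith

theorem expect_nonneg (hX : S.IsBdd X) (h : ∀ ω, 0 ≤ X ω) : 0 ≤ S.expect X := by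
  simpa only [expect_const] using expect_mono (IsBdd.const 0) hX h

theorem expect_le_of_le (hX : S.IsBdd X) {c : ℝ} (h : ∀ ω, X ω ≤ c) : S.expect X ≤ c := by
  simpa only [expect_const] using expect_mono hX (IsBdd.const c) h

end Expect

section Capacity

variable {A B : Set Ω}

theorem capacity_mono (h : A ⊆ B) : S.capacity A ≤ S.capacity B := by
  refine EReal.toENNReal_le_toENNReal (sInf_le_sInf ?_)
  rintro e ⟨ξ, hξ, hle, rfl⟩
  exact ⟨ξ, hξ, fun ω =>
    (Set.indicator_le_indicator_of_subset h (fun _ => zero_le_one) ω).trans (hle ω), rfl⟩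

theorem capacity_le_of_indicator_le (hX : S.IsBdd X)
    (h : ∀ ω, A.indicator (fun _ => (1 : ℝ)) ω ≤ X ω) :
    S.capacity A ≤ ENNReal.ofReal (S.expect X) := by
  have : sInf {e : EReal | ∃ ξ ∈ S.H,
      (∀ ω, A.indicator (fun _ => (1 : ℝ)) ω ≤ ξ ω) ∧ e = S.E ξ} ≤ S.E X :=
    sInf_le ⟨_, hX.1, h, rfl⟩
  rw [← hX.coe_expect] at this
  simpa [capacity] using EReal.toENNReal_le_toENNReal this

theorem capacity_eq_iInf (A : Set Ω) :
    S.capacity A = ⨅ ξ : {ξ // S.IsBdd ξ ∧ ∀ ω, A.indicator (fun _ => (1 : ℝ)) ω ≤ ξ ω},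
      ENNReal.ofReal (S.expect ξ) := by
  refine le_antisymm (le_iInf fun ξ => capacity_le_of_indicator_le ξ.2.1 ξ.2.2)
    (EReal.toENNReal_coe.symm.trans_le (EReal.toENNReal_le_toENNReal (le_sInf ?_)))
  rintro e ⟨ξ, hξ, hle, rfl⟩
  have h0 : ∀ ω, 0 ≤ ξ ω := fun ω => (Set.indicator_nonneg (by simp) ω).trans (hle ω)
  have hbdd : S.IsBdd fun ω => min (ξ ω) 1 :=
    ⟨min_const_mem hξ 1, 1, fun ω => by
      rw [abs_of_nonneg (le_min (h0 ω) zero_le_one)]; exact min_le_right _ _⟩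
  have hle' : ∀ ω, A.indicator (fun _ => (1 : ℝ)) ω ≤ min (ξ ω) 1 := fun ω =>
    le_min (hle ω) (Set.indicator_le_self' (fun _ _ => zero_le_one) ω)
  calc _ ≤ ((ENNReal.ofReal (S.expect fun ω => min (ξ ω) 1) : ℝ≥0∞) : EReal) :=
        EReal.coe_ennreal_le_coe_ennreal_iff.2 (iInf_le_of_le ⟨_, hbdd, hle'⟩ le_rfl)
    _ = S.E fun ω => min (ξ ω) 1 := by
        rw [EReal.coe_ennreal_ofReal, max_eq_left, hbdd.coe_expect]
        exact expect_nonneg hbdd fun ω => le_min (h0 ω) zero_le_one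
    _ ≤ S.E ξ := S.mono _ hξ _ hbdd.1 fun ω => min_le_left _ _

theorem capacity_eq_ofReal_expect (hA : MeasurableSet A) :
    S.capacity A = ENNReal.ofReal (S.expect (A.indicator fun _ => (1 : ℝ))) := by
  refine le_antisymm (capacity_le_of_indicator_le (IsBdd.indicator hA) fun _ => le_rfl) ?_
  rw [capacity_eq_iInf]
  exact le_iInf fun ξ =>
    ENNReal.ofReal_le_ofReal (expect_mono (IsBdd.indicator hA) ξ.2.1 ξ.2.2)

theorem capacity_le_one (A : Set Ω) : S.capacity A ≤ 1 := by
  simpa only [expect_const, ENNReal.ofReal_one] using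
    capacity_le_of_indicator_le (A := A) (IsBdd.const (S := S) 1)
      (Set.indicator_le_self' fun _ _ => zero_le_one)

theorem capacity_ne_top (A : Set Ω) : S.capacity A ≠ ⊤ :=
  ne_top_of_le_ne_top ENNReal.one_ne_top (capacity_le_one A)

theorem capacity_univ : S.capacity Set.univ = 1 := by
  rw [capacity_eq_ofReal_expect .univ, Set.indicator_univ, expect_const, ENNReal.ofReal_one]

theorem capacity_empty : S.capacity ∅ = 0 := by
  rw [capacity_eq_ofReal_expect MeasurableSet.empty, Set.indicator_empty, expect_const,
    ENNReal.ofReal_zero]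

theorem capacity_union_le (A B : Set Ω) :
    S.capacity (A ∪ B) ≤ S.capacity A + S.capacity B := by
  rw [capacity_eq_iInf A, capacity_eq_iInf B]
  refine ENNReal.le_iInf_add_iInf fun ⟨ξ, hξ, hA⟩ ⟨η, hη, hB⟩ => ?_
  have hξ0 : ∀ ω, 0 ≤ ξ ω := fun ω => (Set.indicator_nonneg (by simp) ω).trans (hA ω)
  have hη0 : ∀ ω, 0 ≤ η ω := fun ω => (Set.indicator_nonneg (by simp) ω).trans (hB ω)
  rw [← ENNReal.ofReal_add (expect_nonneg hξ hξ0) (expect_nonneg hη hη0)]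
  refine (capacity_le_of_indicator_le (hξ.add hη) fun ω => ?_).trans
    (ENNReal.ofReal_le_ofReal (expect_add_le hξ hη))
  refine Set.indicator_apply_le' (fun hω => ?_) fun _ => add_nonneg (hξ0 ω) (hη0 ω)
  rcases hω with hω | hω
  · have := hA ω
    rw [Set.indicator_of_mem hω] at this
    linarith [hη0 ω]
  · have := hB ω
    rw [Set.indicator_of_mem hω] at this
    linarith [hξ0 ω]

theorem capacity_biUnion_le {ι : Type*} (s : Finset ι) (A : ι → Set Ω) :
    S.capacity (⋃ i ∈ s, A i) ≤ ∑ i ∈ s, S.capacity (A i) := by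
  classical
  induction s using Finset.induction_on with
  | empty => simp [capacity_empty]
  | insert i s hi ih =>
    rw [Finset.set_biUnion_insert, Finset.sum_insert hi]
    exact (capacity_union_le _ _).trans (by gcongr)

theorem ofReal_capacityReal (A : Set Ω) : ENNReal.ofReal (S.capacityReal A) = S.capacity A :=
  ENNReal.ofReal_toReal (capacity_ne_top A)

theorem capacityReal_nonneg (A : Set Ω) : 0 ≤ S.capacityReal A := ENNReal.toReal_nonneg

theorem capacityReal_le_one (A : Set Ω) : S.capacityReal A ≤ 1 :=
  ENNReal.toReal_le_of_le_ofReal zero_le_one (by simpa using capacity_le_one A)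

theorem capacityReal_eq_expect (hA : MeasurableSet A) :
    S.capacityReal A = S.expect (A.indicator fun _ => (1 : ℝ)) := by
  rw [capacityReal, capacity_eq_ofReal_expect hA, ENNReal.toReal_ofReal]
  exact expect_nonneg (IsBdd.indicator hA) (Set.indicator_nonneg fun _ _ => zero_le_one)

end Capacity

theorem CountablySubadditive.le_tsum_mul_capacity (hS : S.CountablySubadditive) (hX : X ∈ S.H)
    (hX0 : ∀ ω, 0 ≤ X ω) {c : ℕ → ℝ} (hc : ∀ k, 0 ≤ c k) {A : ℕ → Set Ω}
    (hA : ∀ k, MeasurableSet (A k)) (hle : ∀ ω, 0 < X ω → ∃ k, ω ∈ A k ∧ X ω ≤ c k) :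
    S.E X ≤ ((∑' k, ENNReal.ofReal (c k) * S.capacity (A k) : ℝ≥0∞) : EReal) := by
  let Z : ℕ → Ω → ℝ := fun k ω => c k * (A k).indicator (fun _ => (1 : ℝ)) ω
  have hbdd : ∀ k, S.IsBdd (Z k) := fun k => (IsBdd.indicator (hA k)).const_mul (c k)
  have hnonneg : ∀ k ω, 0 ≤ Z k ω := fun k ω =>
    mul_nonneg (hc k) (Set.indicator_nonneg (fun _ _ => zero_le_one) ω)
  have hexpect : ∀ k, (S.E (Z k)).toENNReal = ENNReal.ofReal (c k) * S.capacity (A k) := fun k => by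
    rw [← (hbdd k).coe_expect, EReal.toENNReal_of_ne_top (EReal.coe_ne_top _), EReal.toReal_coe,
      expect_const_mul (IsBdd.indicator (hA k)) (hc k), ENNReal.ofReal_mul (hc k),
      capacity_eq_ofReal_expect (hA k)]
  simp only [← hexpect]
  refine hS X Z hX (fun k => (hbdd k).1) hX0 hnonneg fun ω => ?_
  rcases (hX0 ω).eq_or_lt with h | h
  · simp [← h]
  · obtain ⟨k, hk, hle'⟩ := hle ω h
    exact (ENNReal.ofReal_le_ofReal (by simpa [Z, hk] using hle')).trans
      (ENNReal.le_tsum (f := fun k => ENNReal.ofReal (Z k ω)) k)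

end SublinearExpectationSpace

/-! ### Independent sequences -/

section StoppedProd

/-- The partial products `u 1 * ⋯ * u k`, frozen at the first one that exceeds the level `A`. -/
noncomputable def stoppedProd (u : ℕ → ℝ) (A : ℝ) : ℕ → ℝ
  | 0 => 1
  | k + 1 => if stoppedProd u A k ≤ A then stoppedProd u A k * u (k + 1) else stoppedProd u A k

variable {u : ℕ → ℝ} {A : ℝ}

theorem stoppedProd_succ_of_le {k : ℕ} (h : stoppedProd u A k ≤ A) :
    stoppedProd u A (k + 1) = stoppedProd u A k * u (k + 1) := if_pos h

theorem stoppedProd_succ_of_lt {k : ℕ} (h : A < stoppedProd u A k) :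
    stoppedProd u A (k + 1) = stoppedProd u A k := if_neg h.not_ge

theorem stoppedProd_succ_eq_add (u : ℕ → ℝ) (A : ℝ) (k : ℕ) :
    stoppedProd u A (k + 1) = stoppedProd u A k
      + (Set.Iic A).indicator id (stoppedProd u A k) * (-1 + u (k + 1)) := by
  rcases le_or_gt (stoppedProd u A k) A with h | h
  · rw [stoppedProd_succ_of_le h, Set.indicator_of_mem (Set.mem_Iic.2 h), id]
    ring
  · rw [stoppedProd_succ_of_lt h, Set.indicator_of_notMem (Set.notMem_Iic.2 h), zero_mul, add_zero]

theorem stoppedProd_nonneg (hu : ∀ i, 0 ≤ u i) (k : ℕ) : 0 ≤ stoppedProd u A k := by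
  induction k with
  | zero => exact zero_le_one
  | succ k ih =>
    rcases le_or_gt (stoppedProd u A k) A with h | h
    · rw [stoppedProd_succ_of_le h]
      exact mul_nonneg ih (hu _)
    · rwa [stoppedProd_succ_of_lt h]

theorem lt_stoppedProd_of_le {j k : ℕ} (hjk : j ≤ k) (h : A < stoppedProd u A j) :
    A < stoppedProd u A k := by
  induction k, hjk using Nat.le_induction with
  | base => exact h
  | succ k _ ih => rwa [stoppedProd_succ_of_lt ih]

theorem lt_stoppedProd_or_eq_prod (u : ℕ → ℝ) (A : ℝ) (k : ℕ) :
    A < stoppedProd u A k ∨ stoppedProd u A k = ∏ i ∈ Finset.Icc 1 k, u i := by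
  induction k with
  | zero => right; rfl
  | succ k ih =>
    rcases le_or_gt (stoppedProd u A k) A with h | h
    · right
      rw [stoppedProd_succ_of_le h, ih.resolve_left h.not_gt,
        Finset.prod_Icc_succ_top k.succ_pos]
    · left
      rwa [stoppedProd_succ_of_lt h]

theorem lt_stoppedProd_of_lt_prod {j k : ℕ} (hjk : j ≤ k)
    (h : A < ∏ i ∈ Finset.Icc 1 j, u i) : A < stoppedProd u A k :=
  lt_stoppedProd_of_le hjk <| (lt_stoppedProd_or_eq_prod u A j).elim id fun hj => hj ▸ h

end StoppedProd

namespace SublinearExpectationSpace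

/-- `Z` is a Borel function of `X 1, …, X k`. -/
def DependsOnFirst {Ω : Type*} (X : ℕ → Ω → ℝ) (k : ℕ) (Z : Ω → ℝ) : Prop :=
  ∃ W : (Fin k → ℝ) → ℝ, Measurable W ∧ ∀ ω, Z ω = W fun i => X ((i : ℕ) + 1) ω

namespace DependsOnFirst

variable {Ω : Type*} {X : ℕ → Ω → ℝ} {k : ℕ} {Z : Ω → ℝ}

theorem const (c : ℝ) : DependsOnFirst X k fun _ => c :=
  ⟨fun _ => c, measurable_const, fun _ => rfl⟩

theorem comp (hZ : DependsOnFirst X k Z) {f : ℝ → ℝ} (hf : Measurable f) :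
    DependsOnFirst X k fun ω => f (Z ω) := by
  obtain ⟨W, hW, hZW⟩ := hZ
  exact ⟨fun x => f (W x), hf.comp hW, fun ω => congrArg f (hZW ω)⟩

theorem succ (hZ : DependsOnFirst X k Z) {F : ℝ × ℝ → ℝ} (hF : Measurable F) :
    DependsOnFirst X (k + 1) fun ω => F (Z ω, X (k + 1) ω) := by
  obtain ⟨W, hW, hZW⟩ := hZ
  refine ⟨fun x => F (W (fun i => x i.castSucc), x (Fin.last k)), ?_, fun ω => ?_⟩
  · have hinit : Measurable fun x : Fin (k + 1) → ℝ => W (fun i => x i.castSucc) :=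
      hW.comp (measurable_pi_lambda _ fun i => measurable_pi_apply _)
    exact hF.comp (hinit.prodMk (measurable_pi_apply _))
  · simp [hZW]

theorem stoppedProd {φ : ℕ → ℝ → ℝ} (hφ : ∀ i, Measurable (φ i)) (A : ℝ) (k : ℕ) :
    DependsOnFirst X k fun ω => stoppedProd (fun i => φ i (X i ω)) A k := by
  induction k with
  | zero => exact const 1
  | succ k ih =>
    simp only [stoppedProd_succ_eq_add]
    exact ih.succ (F := fun z => z.1 + (Set.Iic A).indicator id z.1 * (-1 + φ (k + 1) z.2))
      (measurable_fst.add (((measurable_id.indicator measurableSet_Iic).comp measurable_fst).mul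
        (measurable_const.add ((hφ _).comp measurable_snd))))

theorem prod {φ : ℕ → ℝ → ℝ} (hφ : ∀ i, Measurable (φ i)) (k : ℕ) :
    DependsOnFirst X k fun ω => ∏ i ∈ Finset.Icc 1 k, φ i (X i ω) := by
  induction k with
  | zero => exact const 1
  | succ k ih =>
    simp only [Finset.prod_Icc_succ_top k.succ_pos]
    exact ih.succ (F := fun z => z.1 * φ (k + 1) z.2)
      (measurable_fst.mul ((hφ _).comp measurable_snd))

theorem exists_eq_const (hZ : DependsOnFirst X 0 Z) : ∃ c, Z = fun _ => c := by
  obtain ⟨W, -, hZW⟩ := hZ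
  exact ⟨W default, funext fun ω => (hZW ω).trans (congrArg W (Subsingleton.elim _ _))⟩

end DependsOnFirst

variable {Ω : Type*} [MeasurableSpace Ω] {S : SublinearExpectationSpace Ω} {X : ℕ → Ω → ℝ}

namespace IndepSeq

variable {k : ℕ} {Z : Ω → ℝ}

theorem expect_mul_of_pos (hX : S.IndepSeq X) (hk : 0 < k) (hZX : DependsOnFirst X k Z)
    (hZ : S.IsBdd Z) (hZ0 : ∀ ω, 0 ≤ Z ω) {φ : ℝ → ℝ} (hφ : Measurable φ)
    (hφX : S.IsBdd fun ω => φ (X (k + 1) ω)) :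
    S.expect (fun ω => Z ω * φ (X (k + 1) ω))
      = S.expect fun ω => Z ω * S.expect fun ω' => φ (X (k + 1) ω') := by
  obtain ⟨W, hW, hZW⟩ := hZX
  have habs : ∀ ω, (S.E fun ω' => |W (fun i => X ((i : ℕ) + 1) ω) * φ (X (k + 1) ω')|).toReal
      = Z ω * S.expect fun ω' => |φ (X (k + 1) ω')| := fun ω => by
    rw [← hZW, ← expect_const_mul hφX.abs (hZ0 ω)]
    simp only [abs_mul, abs_of_nonneg (hZ0 ω), expect]
  have hmul : ∀ ω, (S.E fun ω' => W (fun i => X ((i : ℕ) + 1) ω) * φ (X (k + 1) ω')).toReal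
      = Z ω * S.expect fun ω' => φ (X (k + 1) ω') := fun ω => by
    rw [← hZW, ← expect_const_mul hφX (hZ0 ω), expect]
  have hbdd : ∀ c : ℝ, S.IsBdd fun ω => Z ω * c := fun c => hZ.mul (IsBdd.const c)
  have hE_lt : ∀ {Y : Ω → ℝ}, S.IsBdd Y → S.E Y < ⊤ := fun hY =>
    hY.coe_expect ▸ EReal.coe_lt_top _
  have key := hX k hk (fun z => W z.1 * φ (z.2 0))
    ((hW.comp measurable_fst).mul (hφ.comp ((measurable_pi_apply 0).comp measurable_snd)))
    (by simpa only [← hZW] using (hZ.mul hφX).1)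
    (fun x => (hφX.const_mul (W x)).1)
    (fun x => hE_lt (hφX.const_mul (W x)).abs)
    (by simpa only [habs] using (hbdd _).1)
    (by simpa only [habs] using hE_lt (hbdd _).abs)
    (by simpa only [hmul] using (hbdd _).1)
  simp only [hmul] at key
  simp only [← hZW] at key
  exact congrArg EReal.toReal key

theorem expect_mul (hX : S.IndepSeq X) (hZX : DependsOnFirst X k Z)
    (hZ : S.IsBdd Z) (hZ0 : ∀ ω, 0 ≤ Z ω) {φ : ℝ → ℝ} (hφ : Measurable φ)
    (hφX : S.IsBdd fun ω => φ (X (k + 1) ω)) :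
    S.expect (fun ω => Z ω * φ (X (k + 1) ω))
      = S.expect fun ω => Z ω * S.expect fun ω' => φ (X (k + 1) ω') := by
  rcases k.eq_zero_or_pos with rfl | hk
  · obtain ⟨c, rfl⟩ := hZX.exists_eq_const
    rcases isEmpty_or_nonempty Ω with hΩ | ⟨⟨ω⟩⟩
    · exact congrArg S.expect (Subsingleton.elim _ _)
    · rw [expect_const_mul hφX (hZ0 ω), expect_const]
  · exact hX.expect_mul_of_pos hk hZX hZ hZ0 hφ hφX

end IndepSeq

section StoppedProd

variable {φ : ℕ → ℝ → ℝ}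

theorem IsBdd.indicator_Iic_id {Z : Ω → ℝ} (hZ : S.IsBdd Z) (A : ℝ) :
    S.IsBdd fun ω => (Set.Iic A).indicator id (Z ω) := by
  have h : ∀ ω, (Set.Iic A).indicator id (Z ω) = {ω | Z ω ≤ A}.indicator (fun _ => 1) ω * Z ω :=
    fun ω => by by_cases hω : Z ω ≤ A <;> simp [hω]
  simp only [h]
  exact (IsBdd.indicator (measurableSet_le (S.measurable_of_mem _ hZ.1) measurable_const)).mul hZ

theorem IsBdd.stoppedProd (hφX : ∀ i, 1 ≤ i → S.IsBdd fun ω => φ i (X i ω)) (A : ℝ) (k : ℕ) :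
    S.IsBdd fun ω => stoppedProd (fun i => φ i (X i ω)) A k := by
  induction k with
  | zero => exact IsBdd.const 1
  | succ k ih =>
    simp only [stoppedProd_succ_eq_add]
    exact ih.add ((ih.indicator_Iic_id A).mul
      ((IsBdd.const (-1)).add (hφX (k + 1) k.succ_pos)))

theorem IndepSeq.expect_stoppedProd_le_one (hX : S.IndepSeq X) (hφ : ∀ i, Measurable (φ i))
    (hφ0 : ∀ i x, 0 ≤ φ i x) (hφX : ∀ i, 1 ≤ i → S.IsBdd fun ω => φ i (X i ω))
    (hE : ∀ i, 1 ≤ i → S.expect (fun ω => φ i (X i ω)) ≤ 1) (A : ℝ) (k : ℕ) :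
    S.expect (fun ω => stoppedProd (fun i => φ i (X i ω)) A k) ≤ 1 := by
  induction k with
  | zero => exact (expect_const 1).le
  | succ k ih =>
    have hP := IsBdd.stoppedProd hφX A k
    have hZ := hP.indicator_Iic_id A
    have hincr := (IsBdd.const (-1)).add (hφX (k + 1) k.succ_pos)
    have hZ0 : ∀ ω, 0 ≤ (Set.Iic A).indicator id (stoppedProd (fun i => φ i (X i ω)) A k) :=
      fun ω => Set.indicator_apply_nonneg fun _ => stoppedProd_nonneg (fun i => hφ0 i _) k
    have hincr_le : S.expect (fun ω => -1 + φ (k + 1) (X (k + 1) ω)) ≤ 0 := by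
      rw [expect_const_add (hφX (k + 1) k.succ_pos)]
      linarith [hE (k + 1) k.succ_pos]
    have hdrift : S.expect (fun ω => (Set.Iic A).indicator id
        (stoppedProd (fun i => φ i (X i ω)) A k) * (-1 + φ (k + 1) (X (k + 1) ω))) ≤ 0 := by
      rw [hX.expect_mul ((DependsOnFirst.stoppedProd hφ A k).comp
        (measurable_id.indicator measurableSet_Iic)) hZ hZ0 (φ := fun x => -1 + φ (k + 1) x)
        (measurable_const.add (hφ _)) hincr]
      exact expect_le_of_le (hZ.mul (IsBdd.const _)) fun ω =>
        mul_nonpos_of_nonneg_of_nonpos (hZ0 ω) hincr_le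
    simp only [stoppedProd_succ_eq_add]
    linarith [expect_add_le hP (hZ.mul hincr)]

theorem IndepSeq.capacity_exists_lt_prod_le (hX : S.IndepSeq X) (hφ : ∀ i, Measurable (φ i))
    (hφ0 : ∀ i x, 0 ≤ φ i x) (hφX : ∀ i, 1 ≤ i → S.IsBdd fun ω => φ i (X i ω))
    (hE : ∀ i, 1 ≤ i → S.expect (fun ω => φ i (X i ω)) ≤ 1) {A : ℝ} (hA : 0 < A) (n : ℕ) :
    S.capacity {ω | ∃ j ≤ n, A < ∏ i ∈ Finset.Icc 1 j, φ i (X i ω)} ≤ ENNReal.ofReal A⁻¹ := by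
  have hP := IsBdd.stoppedProd hφX A n
  have hA' : 0 ≤ A⁻¹ := inv_nonneg.2 hA.le
  refine (capacity_le_of_indicator_le (hP.const_mul A⁻¹) fun ω => ?_).trans
    (ENNReal.ofReal_le_ofReal ?_)
  · refine Set.indicator_apply_le' (fun ⟨j, hj, h⟩ => ?_)
      fun _ => mul_nonneg hA' (stoppedProd_nonneg (fun i => hφ0 i _) n)
    rw [inv_mul_eq_div, one_le_div hA]
    exact (lt_stoppedProd_of_lt_prod hj h).le
  · rw [expect_const_mul hP hA']
    exact mul_le_of_le_one_right hA' (hX.expect_stoppedProd_le_one hφ hφ0 hφX hE A n)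

/-- The lower expectation `-E[-·]` is multiplicative along an independent sequence. -/
theorem IndepSeq.expect_neg_prod (hX : S.IndepSeq X) (hφ : ∀ i, Measurable (φ i))
    (hφ0 : ∀ i x, 0 ≤ φ i x) (hφX : ∀ i, 1 ≤ i → S.IsBdd fun ω => φ i (X i ω)) (n : ℕ) :
    S.expect (fun ω => -∏ i ∈ Finset.Icc 1 n, φ i (X i ω))
      = -∏ i ∈ Finset.Icc 1 n, -S.expect fun ω => -φ i (X i ω) := by
  induction n with
  | zero => simp [expect_const]
  | succ n ih =>
    let Q : Ω → ℝ := fun ω => ∏ i ∈ Finset.Icc 1 n, φ i (X i ω)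
    have hQ : S.IsBdd Q := IsBdd.prod _ fun i hi => hφX i (Finset.mem_Icc.1 hi).1
    have hφn := (hφX (n + 1) n.succ_pos).neg
    have hlower : 0 ≤ -S.expect fun ω => -φ (n + 1) (X (n + 1) ω) :=
      neg_nonneg.2 (expect_le_of_le hφn fun ω => neg_nonpos.2 (hφ0 _ _))
    calc S.expect (fun ω => -∏ i ∈ Finset.Icc 1 (n + 1), φ i (X i ω))
        = S.expect (fun ω => Q ω * -φ (n + 1) (X (n + 1) ω)) := by
          simp only [Finset.prod_Icc_succ_top n.succ_pos, Q, mul_neg]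
      _ = S.expect (fun ω => (-S.expect fun ω' => -φ (n + 1) (X (n + 1) ω')) * -Q ω) := by
          rw [hX.expect_mul (DependsOnFirst.prod hφ n) hQ
            (fun ω => Finset.prod_nonneg fun i _ => hφ0 i _) (φ := fun x => -φ (n + 1) x)
            (hφ _).neg hφn]
          simp only [neg_mul_neg, mul_comm, Q]
      _ = _ := by
          rw [expect_const_mul hQ.neg hlower, ih, Finset.prod_Icc_succ_top n.succ_pos]
          ring

end StoppedProd

theorem IndepSeq.capacity_exists_mem_eq (hX : S.IndepSeq X) (hXm : ∀ i, 1 ≤ i → Measurable (X i))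
    {B : ℕ → Set ℝ} (hB : ∀ i, MeasurableSet (B i)) (n : ℕ) :
    S.capacity {ω | ∃ i ∈ Finset.Icc 1 n, X i ω ∈ B i} = ENNReal.ofReal
      (1 - ∏ i ∈ Finset.Icc 1 n, (1 - S.capacityReal (X i ⁻¹' B i))) := by
  let φ : ℕ → ℝ → ℝ := fun i => (B i)ᶜ.indicator fun _ => 1
  have hφ : ∀ i, Measurable (φ i) := fun i => measurable_const.indicator (hB i).compl
  have hφX : ∀ i, 1 ≤ i → S.IsBdd fun ω => φ i (X i ω) := fun i hi =>
    IsBdd.indicator (hXm i hi (hB i).compl)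
  have hlower : ∀ i, 1 ≤ i →
      -S.expect (fun ω => -φ i (X i ω)) = 1 - S.capacityReal (X i ⁻¹' B i) := fun i hi => by
    have hind : ∀ ω, -φ i (X i ω) = -1 + (X i ⁻¹' B i).indicator (fun _ => 1) ω := fun ω => by
      by_cases h : X i ω ∈ B i <;> simp [φ, h]
    simp only [hind]
    rw [expect_const_add (IsBdd.indicator (hXm i hi (hB i))),
      ← capacityReal_eq_expect (hXm i hi (hB i))]
    ring
  have hset : MeasurableSet {ω | ∃ i ∈ Finset.Icc 1 n, X i ω ∈ B i} := by
    have hunion : {ω | ∃ i ∈ Finset.Icc 1 n, X i ω ∈ B i}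
        = ⋃ i ∈ Finset.Icc 1 n, X i ⁻¹' B i := by ext; simp
    rw [hunion]
    exact Finset.measurableSet_biUnion _ fun i hi => hXm i (Finset.mem_Icc.1 hi).1 (hB i)
  have hind : ({ω | ∃ i ∈ Finset.Icc 1 n, X i ω ∈ B i}.indicator fun _ => (1 : ℝ))
      = fun ω => 1 + -∏ i ∈ Finset.Icc 1 n, φ i (X i ω) := by
    funext ω
    by_cases h : ∃ i ∈ Finset.Icc 1 n, X i ω ∈ B i
    · obtain ⟨i, hi, hiB⟩ := id h
      rw [Set.indicator_of_mem (by exact h), Finset.prod_eq_zero hi (by simp [φ, hiB]),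
        neg_zero, add_zero]
    · rw [Set.indicator_of_notMem (by exact h), Finset.prod_eq_one fun i hi => ?_, add_neg_cancel]
      exact Set.indicator_of_mem (s := (B i)ᶜ) (fun hiB => h ⟨i, hi, hiB⟩) _
  have hprod : S.IsBdd fun ω => ∏ i ∈ Finset.Icc 1 n, φ i (X i ω) :=
    IsBdd.prod _ fun i hi => hφX i (Finset.mem_Icc.1 hi).1
  rw [capacity_eq_ofReal_expect hset, hind, expect_const_add hprod.neg,
    hX.expect_neg_prod hφ (fun i x => Set.indicator_nonneg (fun _ _ => zero_le_one) x) hφX,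
    Finset.prod_congr rfl fun i hi => hlower i (Finset.mem_Icc.1 hi).1, sub_eq_add_neg]

end SublinearExpectationSpace

/-! ### Truncation and an exponential maximal inequality -/

/-- Truncation of a real number to the interval `[-δ, δ]`. -/
noncomputable def clip (δ x : ℝ) : ℝ := max (min x δ) (-δ)

section Clip

variable {δ : ℝ}

theorem clip_of_abs_le {x : ℝ} (h : |x| ≤ δ) : clip δ x = x := by
  rw [clip, min_eq_left (abs_le.1 h).2, max_eq_left (abs_le.1 h).1]

theorem abs_clip (hδ : 0 ≤ δ) (x : ℝ) : |clip δ x| = min |x| δ := by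
  unfold clip
  rcases le_total 0 x with h | h
  · rw [abs_of_nonneg h, max_eq_left, abs_of_nonneg (le_min h hδ)]
    exact (neg_nonpos.2 hδ).trans (le_min h hδ)
  · rw [abs_of_nonpos h, min_eq_left (h.trans hδ), abs_of_nonpos (max_le h (by linarith)),
      ← min_neg_neg, neg_neg]

theorem abs_clip_le (hδ : 0 ≤ δ) (x : ℝ) : |clip δ x| ≤ δ := by
  rw [abs_clip hδ]
  exact min_le_right _ _

theorem clip_neg (hδ : 0 ≤ δ) (x : ℝ) : clip δ (-x) = -clip δ x := by
  have h : -δ ≤ δ := by linarith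
  rw [clip, clip, ← min_neg_neg, ← max_neg_neg, neg_neg, max_min_distrib_right, max_eq_left h]

theorem clip_le_add_excess (δ x : ℝ) : clip δ x ≤ x + max (|x| - δ) 0 :=
  max_le ((min_le_left _ _).trans (le_add_of_nonneg_right (le_max_right _ _)))
    (by linarith [neg_abs_le x, le_max_left (|x| - δ) 0])

theorem measurable_clip (δ : ℝ) : Measurable (clip δ) :=
  (measurable_id.min measurable_const).max measurable_const

end Clip

theorem exp_le_one_add_add_sq_mul_exp {u L : ℝ} (h : |u| ≤ L) :
    Real.exp u ≤ 1 + u + Real.exp L * u ^ 2 := by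
  have htaylor : |Real.exp u - (1 + u)| ≤ u ^ 2 * Real.exp |u| := by
    have := Complex.norm_exp_sub_sum_le_norm_mul_exp u 2
    simp only [Finset.sum_range_succ, Finset.sum_range_zero, Nat.factorial, pow_zero, pow_one,
      Complex.norm_real, Real.norm_eq_abs, sq_abs] at this
    norm_num at this
    exact_mod_cast this
  have hL : u ^ 2 * Real.exp |u| ≤ u ^ 2 * Real.exp L := by gcongr
  linarith [le_abs_self (Real.exp u - (1 + u))]

namespace SublinearExpectationSpace

variable {Ω : Type*} [MeasurableSpace Ω] {S : SublinearExpectationSpace Ω}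

theorem IsBdd.clip {X : Ω → ℝ} (hX : X ∈ S.H) {δ : ℝ} (hδ : 0 ≤ δ) :
    S.IsBdd fun ω => clip δ (X ω) :=
  ⟨max_const_mem (min_const_mem hX δ) (-δ), δ, fun _ => abs_clip_le hδ _⟩

theorem IsBdd.pow {X : Ω → ℝ} (hX : S.IsBdd X) (n : ℕ) : S.IsBdd fun ω => X ω ^ n := by
  simpa only [Finset.prod_const, Finset.card_range] using IsBdd.prod (Finset.range n) fun _ _ => hX

section Moments

variable {X : Ω → ℝ} {K q δ : ℝ}

/-- The tail of `X` has power decay of order `q` with constant `K`. -/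
def HasTailDecay (S : SublinearExpectationSpace Ω) (X : Ω → ℝ) (K q : ℝ) : Prop :=
  ∀ t, 0 < t → S.capacityReal {ω | t < |X ω|} ≤ K * t ^ (-q)

theorem HasTailDecay.nonneg (h : S.HasTailDecay X K q) : 0 ≤ K := by
  simpa using (capacityReal_nonneg _).trans (h 1 one_pos)

theorem HasTailDecay.const_mul (h : S.HasTailDecay X K q) (a : ℝ) :
    S.HasTailDecay (fun ω => a * X ω) (K * |a| ^ q) q := fun t ht => by
  have hK := h.nonneg
  rcases eq_or_ne a 0 with rfl | ha
  · have hempty : {ω | t < |0 * X ω|} = ∅ := by simp [Set.eq_empty_iff_forall_notMem, ht.le]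
    rw [hempty, capacityReal, capacity_empty, ENNReal.toReal_zero]
    positivity
  have ha' := abs_pos.2 ha
  have hset : {ω | t < |a * X ω|} = {ω | t / |a| < |X ω|} := by
    ext ω
    simp only [Set.mem_ofPred_eq, abs_mul, div_lt_iff₀ ha', mul_comm]
  rw [hset]
  refine (h _ (div_pos ht ha')).trans_eq ?_
  rw [Real.div_rpow ht.le ha'.le, Real.rpow_neg ha'.le, div_inv_eq_mul]
  ring

theorem HasTailDecay.le_of_geometric_levels (hS : S.CountablySubadditive)
    (h : S.HasTailDecay X K q) (hX : Measurable X) {Z : Ω → ℝ} (hZ : Z ∈ S.H) (hZ0 : ∀ ω, 0 ≤ Z ω)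
    {c x μ r : ℝ} (hc : 0 ≤ c) (hx : 0 < x) (hμ : 0 ≤ μ) (hr : 0 < r) (hμr : μ * r ^ (-q) < 1)
    (hle : ∀ ω, 0 < Z ω → ∃ k : ℕ, x * r ^ k < |X ω| ∧ Z ω ≤ c * μ ^ k) :
    S.E Z ≤ ((c * x ^ (-q) * (1 - μ * r ^ (-q))⁻¹ * K : ℝ) : EReal) := by
  have hρ : 0 ≤ μ * r ^ (-q) := by positivity
  have hterm : ∀ k : ℕ, c * μ ^ k * (K * (x * r ^ k) ^ (-q))
      = c * x ^ (-q) * K * (μ * r ^ (-q)) ^ k := fun k => by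
    rw [Real.mul_rpow hx.le (by positivity), ← Real.rpow_pow_comm hr.le]
    ring
  have hK := h.nonneg
  refine (hS.le_tsum_mul_capacity hZ hZ0 (fun k => by positivity)
    (fun k => measurableSet_lt measurable_const hX.abs) hle).trans ?_
  calc ((∑' k : ℕ, ENNReal.ofReal (c * μ ^ k) * S.capacity {ω | x * r ^ k < |X ω|} : ℝ≥0∞) : EReal)
      ≤ ((∑' k, ENNReal.ofReal (c * x ^ (-q) * K * (μ * r ^ (-q)) ^ k) : ℝ≥0∞) : EReal) := by
        refine EReal.coe_ennreal_le_coe_ennreal_iff.2 (ENNReal.tsum_le_tsum fun k => ?_)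
        rw [← hterm, ← ofReal_capacityReal, ← ENNReal.ofReal_mul (by positivity)]
        gcongr
        exact h _ (by positivity)
    _ = _ := by
        rw [← ENNReal.ofReal_tsum_of_nonneg (fun k => by positivity)
          ((summable_geometric_of_lt_one hρ hμr).mul_left _), tsum_mul_left,
          tsum_geometric_of_lt_one hρ hμr, EReal.coe_ennreal_ofReal, max_eq_left]
        · congr 1
          ring
        · have := sub_pos.2 hμr
          positivity

theorem CountablySubadditive.exists_expect_abs_clip_pow_le (hS : S.CountablySubadditive)
    (hδ : 0 < δ) {n : ℕ} (hn : n ≠ 0) (hqn : q < n) :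
    ∃ C : ℝ, ∀ Y ∈ S.H, ∀ K, S.HasTailDecay Y K q →
      S.expect (fun ω => |clip δ (Y ω)| ^ n) ≤ C * K := by
  have hratio : (1 / 2 : ℝ) ^ n * (1 / 2) ^ (-q) < 1 := by
    rw [← Real.rpow_natCast, ← Real.rpow_add (by norm_num)]
    exact Real.rpow_lt_one (by norm_num) (by norm_num) (by linarith)
  refine ⟨δ ^ n * (δ / 2) ^ (-q) * (1 - (1 / 2) ^ n * (1 / 2) ^ (-q))⁻¹, fun Y hY K hK => ?_⟩
  have hbdd := (IsBdd.clip hY hδ.le).abs.pow n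
  rw [← EReal.coe_le_coe_iff, hbdd.coe_expect]
  refine hK.le_of_geometric_levels hS (S.measurable_of_mem Y hY) hbdd.1 (fun ω => by positivity)
    (by positivity) (by positivity) (by positivity) (by positivity) hratio fun ω hω => ?_
  have hclip := abs_clip hδ.le (Y ω)
  have hpos : 0 < |clip δ (Y ω)| / δ :=
    div_pos (lt_of_pow_lt_pow_left₀ n (abs_nonneg _) (by rwa [zero_pow hn])) hδ
  obtain ⟨k, hk_lt, hk_le⟩ := exists_nat_pow_near_of_lt_one (y := (1 / 2 : ℝ)) hpos
    ((div_le_one hδ).2 (abs_clip_le hδ.le _)) (by norm_num) (by norm_num)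
  refine ⟨k, ?_, ?_⟩
  · rw [lt_div_iff₀ hδ, hclip, pow_succ] at hk_lt
    linarith [min_le_left |Y ω| δ]
  · rw [div_le_iff₀' hδ] at hk_le
    rw [← pow_mul, mul_comm n k, pow_mul, ← mul_pow]
    gcongr

theorem excess_mem {Y : Ω → ℝ} (hY : Y ∈ S.H) (δ : ℝ) : (fun ω => max (|Y ω| - δ) 0) ∈ S.H := by
  simpa only [sub_eq_add_neg] using max_const_mem (add_mem (abs_mem hY) (const_mem (-δ))) 0

theorem CountablySubadditive.exists_excess_le (hS : S.CountablySubadditive)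
    (hδ : 0 < δ) (hq : 1 < q) :
    ∃ C : ℝ, ∀ Y ∈ S.H, ∀ K, S.HasTailDecay Y K q →
      S.E (fun ω => max (|Y ω| - δ) 0) ≤ ((C * K : ℝ) : EReal) := by
  have hratio : (2 : ℝ) * 2 ^ (-q) < 1 := by
    rw [← Real.rpow_one_add' two_pos.le (by linarith)]
    exact Real.rpow_lt_one_of_one_lt_of_neg one_lt_two (by linarith)
  refine ⟨2 * δ * (δ / 2) ^ (-q) * (1 - 2 * 2 ^ (-q))⁻¹, fun Y hY K hK => ?_⟩
  refine hK.le_of_geometric_levels hS (S.measurable_of_mem Y hY) (excess_mem hY δ)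
    (fun ω => le_max_right _ _) (by positivity) (by positivity) two_pos.le two_pos hratio
    fun ω hω => ?_
  have hδY : δ < |Y ω| := by simpa using hω
  obtain ⟨k, hk_le, hk_lt⟩ := exists_nat_pow_near ((one_le_div hδ).2 hδY.le) one_lt_two
  refine ⟨k, ?_, ?_⟩
  · rw [le_div_iff₀ hδ] at hk_le
    have : 0 < 2 ^ k * δ := by positivity
    linarith
  · rw [div_lt_iff₀ hδ, pow_succ] at hk_lt
    exact max_le (by linarith) (by positivity)

theorem CountablySubadditive.exists_expect_clip_le (hS : S.CountablySubadditive)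
    (hδ : 0 < δ) (hq : q ≠ 1) :
    ∃ C : ℝ, ∀ Y ∈ S.H, ∀ K, S.HasTailDecay Y K q → (1 < q → S.E Y = 0) →
      S.expect (fun ω => clip δ (Y ω)) ≤ C * K := by
  rcases hq.lt_or_gt with hq | hq
  · obtain ⟨C, hC⟩ := hS.exists_expect_abs_clip_pow_le hδ one_ne_zero (by simpa using hq)
    refine ⟨C, fun Y hY K hK _ => le_trans ?_ (hC Y hY K hK)⟩
    have hbdd := IsBdd.clip hY hδ.le
    simp only [pow_one]
    exact expect_mono hbdd hbdd.abs fun ω => le_abs_self _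
  · obtain ⟨C, hC⟩ := hS.exists_excess_le hδ hq
    refine ⟨C, fun Y hY K hK hmean => ?_⟩
    have hE := hmean hq
    have hexcess := excess_mem hY δ
    rw [← EReal.coe_le_coe_iff, (IsBdd.clip hY hδ.le).coe_expect]
    calc S.E (fun ω => clip δ (Y ω))
        ≤ S.E (fun ω => Y ω + max (|Y ω| - δ) 0) :=
          S.mono _ (add_mem hY hexcess) _ (IsBdd.clip hY hδ.le).1 fun ω => clip_le_add_excess δ _
      _ ≤ S.E Y + S.E (fun ω => max (|Y ω| - δ) 0) :=
          S.subadditive _ hY _ hexcess (by simp [hE]) (by simp [hE])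
      _ ≤ ((C * K : ℝ) : EReal) := by
          rw [hE, zero_add]
          exact hC Y hY K hK

end Moments

section ExponentialInequality

/-- A quadratic majorant of `exp (l * y)`, normalized so that its expectation at a variable with
mean at most `m` and second moment at most `v` is at most `1`. -/
noncomputable def expMajorant (l κ m v y : ℝ) : ℝ :=
  Real.exp (-(l * m + κ * v)) * (1 + (l * y + κ * y ^ 2))

variable {l κ m v δ : ℝ}

theorem exp_le_expMajorant (hl : 0 ≤ l) {y : ℝ} (hy : |y| ≤ δ) :
    Real.exp (-(l * m + l ^ 2 * Real.exp (l * δ) * v) + l * y)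
      ≤ expMajorant l (l ^ 2 * Real.exp (l * δ)) m v y := by
  have hly : |l * y| ≤ l * δ := by
    rw [abs_mul, abs_of_nonneg hl]
    gcongr
  rw [Real.exp_add, expMajorant]
  gcongr
  linarith [exp_le_one_add_add_sq_mul_exp hly]

theorem measurable_expMajorant (l κ m v : ℝ) : Measurable (expMajorant l κ m v) := by
  unfold expMajorant
  fun_prop

theorem IsBdd.expMajorant {Y : Ω → ℝ} (hY : S.IsBdd Y) (l κ m v : ℝ) :
    S.IsBdd fun ω => expMajorant l κ m v (Y ω) :=
  ((IsBdd.const 1).add ((hY.const_mul l).add ((hY.pow 2).const_mul κ))).const_mul _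

theorem expect_expMajorant_le_one {Y : Ω → ℝ} (hY : S.IsBdd Y) (hl : 0 ≤ l) (hκ : 0 ≤ κ)
    (hm : S.expect Y ≤ m) (hv : S.expect (fun ω => Y ω ^ 2) ≤ v) :
    S.expect (fun ω => expMajorant l κ m v (Y ω)) ≤ 1 := by
  have hlin := hY.const_mul l
  have hquad := (hY.pow 2).const_mul κ
  calc S.expect (fun ω => expMajorant l κ m v (Y ω))
      = Real.exp (-(l * m + κ * v))
          * (1 + S.expect fun ω => l * Y ω + κ * Y ω ^ 2) := by
        simp only [SublinearExpectationSpace.expMajorant]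
        rw [expect_const_mul ((IsBdd.const 1).add (hlin.add hquad)) (Real.exp_pos _).le,
          expect_const_add (hlin.add hquad)]
    _ ≤ Real.exp (-(l * m + κ * v)) * (1 + (l * m + κ * v)) := by
        have hadd := expect_add_le hlin hquad
        rw [expect_const_mul hY hl, expect_const_mul (hY.pow 2) hκ] at hadd
        gcongr
        exact hadd.trans (by gcongr)
    _ ≤ Real.exp (-(l * m + κ * v)) * Real.exp (l * m + κ * v) := by
        gcongr
        linarith [Real.add_one_le_exp (l * m + κ * v)]
    _ = 1 := by rw [← Real.exp_add, neg_add_cancel, Real.exp_zero]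

theorem IndepSeq.capacity_exists_lt_sum_le {X : ℕ → Ω → ℝ} (hX : S.IndepSeq X)
    {g : ℕ → ℝ → ℝ} (hg : ∀ i, Measurable (g i)) (hgδ : ∀ i x, |g i x| ≤ δ)
    (hgX : ∀ i, 1 ≤ i → S.IsBdd fun ω => g i (X i ω)) {m v : ℕ → ℝ}
    (hm0 : ∀ i, 0 ≤ m i) (hv0 : ∀ i, 0 ≤ v i)
    (hm : ∀ i, 1 ≤ i → S.expect (fun ω => g i (X i ω)) ≤ m i)
    (hv : ∀ i, 1 ≤ i → S.expect (fun ω => g i (X i ω) ^ 2) ≤ v i) (hl : 0 < l)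
    (ε : ℝ) (n : ℕ) :
    S.capacity {ω | ∃ j ≤ n, ε < ∑ i ∈ Finset.Icc 1 j, g i (X i ω)}
      ≤ ENNReal.ofReal (Real.exp (-(l * ε) + ∑ i ∈ Finset.Icc 1 n,
          (l * m i + l ^ 2 * Real.exp (l * δ) * v i))) := by
  set κ := l ^ 2 * Real.exp (l * δ)
  set M := ∑ i ∈ Finset.Icc 1 n, (l * m i + κ * v i)
  let φ : ℕ → ℝ → ℝ := fun i x => expMajorant l κ (m i) (v i) (g i x)
  have hφexp : ∀ i x, Real.exp (-(l * m i + κ * v i) + l * g i x) ≤ φ i x := fun i x =>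
    exp_le_expMajorant hl.le (hgδ i x)
  have hville := hX.capacity_exists_lt_prod_le (φ := φ)
    (fun i => (measurable_expMajorant _ _ _ _).comp (hg i))
    (fun i x => (Real.exp_pos _).le.trans (hφexp i x)) (fun i hi => (hgX i hi).expMajorant _ _ _ _)
    (fun i hi => expect_expMajorant_le_one (hgX i hi) hl.le (by positivity) (hm i hi) (hv i hi))
    (Real.exp_pos (l * ε - M)) n
  rw [← Real.exp_neg, neg_sub, sub_eq_neg_add M] at hville
  refine (capacity_mono ?_).trans hville
  rintro ω ⟨j, hj, hlt⟩
  refine ⟨j, hj, ?_⟩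
  have hM : ∑ i ∈ Finset.Icc 1 j, (l * m i + κ * v i) ≤ M :=
    Finset.sum_le_sum_of_subset_of_nonneg (Finset.Icc_subset_Icc_right hj)
      fun i _ _ => add_nonneg (mul_nonneg hl.le (hm0 i)) (mul_nonneg (by positivity) (hv0 i))
  calc Real.exp (l * ε - M)
      < Real.exp (∑ i ∈ Finset.Icc 1 j, (-(l * m i + κ * v i) + l * g i (X i ω))) := by
        rw [Real.exp_lt_exp, Finset.sum_add_distrib, Finset.sum_neg_distrib, ← Finset.mul_sum]
        linarith [mul_lt_mul_of_pos_left hlt hl]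
    _ = ∏ i ∈ Finset.Icc 1 j, Real.exp (-(l * m i + κ * v i) + l * g i (X i ω)) :=
        Real.exp_sum _ _
    _ ≤ ∏ i ∈ Finset.Icc 1 j, φ i (X i ω) :=
        Finset.prod_le_prod (fun _ _ => (Real.exp_pos _).le) fun i _ => hφexp i _

end ExponentialInequality

end SublinearExpectationSpace

/-! ### Power sums and orders of growth -/

/-- The sum of `i ^ γ` over the positive integers `i ≤ x`. -/
noncomputable def rpowSum (γ x : ℝ) : ℝ :=
  ∑ i ∈ Finset.Icc 1 ⌊x⌋₊, (i : ℝ) ^ γ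

section PowerSums

variable {γ x : ℝ}

theorem rpowSum_nonneg (γ x : ℝ) : 0 ≤ rpowSum γ x :=
  Finset.sum_nonneg fun _ _ => by positivity

theorem rpowSum_eq_zero (h : x < 1) : rpowSum γ x = 0 := by
  simp [rpowSum, Nat.floor_eq_zero.2 h]

theorem rpowSum_natCast (γ : ℝ) (n : ℕ) :
    rpowSum γ n = ∑ i ∈ Finset.Icc 1 n, (i : ℝ) ^ γ := by
  rw [rpowSum, Nat.floor_natCast]

theorem rpowSum_neg_one (x : ℝ) : rpowSum (-1) x = harmonic ⌊x⌋₊ := by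
  simp [rpowSum, harmonic_eq_sum_Icc, Real.rpow_neg_one]

theorem exists_rpowSum_le (hγ : γ < -1) : ∃ C : ℝ, 0 ≤ C ∧ ∀ x, rpowSum γ x ≤ C :=
  ⟨∑' n : ℕ, (n : ℝ) ^ γ, tsum_nonneg fun _ => by positivity, fun _ =>
    (Real.summable_nat_rpow.2 hγ).sum_le_tsum _ fun _ _ => by positivity⟩

theorem one_le_rpowSum (hx : 1 ≤ x) : 1 ≤ rpowSum γ x := by
  have h1 : 1 ∈ Finset.Icc 1 ⌊x⌋₊ := Finset.mem_Icc.2 ⟨le_rfl, Nat.le_floor (by simpa using hx)⟩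
  simpa [rpowSum] using
    Finset.single_le_sum (f := fun i : ℕ => (i : ℝ) ^ γ) (fun i _ => by positivity) h1

theorem rpow_add_mul_rpow_sub_one_le {q : ℝ} (hq0 : 0 ≤ q) (hq1 : q ≤ 1) (n : ℕ) :
    (n : ℝ) ^ q + q * (n + 1 : ℝ) ^ (q - 1) ≤ (n + 1 : ℝ) ^ q := by
  have hn : (0 : ℝ) < n + 1 := by positivity
  have hinv : -1 ≤ -(1 / (n + 1 : ℝ)) :=
    neg_le_neg ((div_le_one hn).2 (by linarith [n.cast_nonneg (α := ℝ)]))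
  have hbernoulli := rpow_one_add_le_one_add_mul_self hinv hq0 hq1
  have hsplit : (n : ℝ) = (n + 1) * (1 + -(1 / (n + 1 : ℝ))) := by
    field_simp
    ring
  calc (n : ℝ) ^ q + q * (n + 1 : ℝ) ^ (q - 1)
      = (n + 1 : ℝ) ^ q * (1 + -(1 / (n + 1 : ℝ))) ^ q + q * (n + 1 : ℝ) ^ (q - 1) := by
        rw [← Real.mul_rpow hn.le (by linarith), ← hsplit]
    _ ≤ (n + 1 : ℝ) ^ q * (1 + q * -(1 / (n + 1 : ℝ))) + q * (n + 1 : ℝ) ^ (q - 1) := by gcongr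
    _ = (n + 1 : ℝ) ^ q := by
        rw [Real.rpow_sub_one hn.ne']
        ring

theorem exists_rpowSum_natCast_le (hγ : -1 < γ) :
    ∃ C : ℝ, 0 < C ∧ ∀ N : ℕ, rpowSum γ N ≤ C * (N : ℝ) ^ (γ + 1) := by
  have hγ1 : 0 < γ + 1 := by linarith
  simp only [rpowSum_natCast]
  rcases le_total 0 γ with hγ0 | hγ0
  · refine ⟨1, one_pos, fun N => ?_⟩
    calc ∑ n ∈ Finset.Icc 1 N, (n : ℝ) ^ γ ≤ ∑ _n ∈ Finset.Icc 1 N, (N : ℝ) ^ γ := by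
          refine Finset.sum_le_sum fun n hn => ?_
          gcongr
          exact (Finset.mem_Icc.1 hn).2
      _ = 1 * (N : ℝ) ^ (γ + 1) := by
          rw [Real.rpow_add_one' (by positivity) hγ1.ne']
          simp [mul_comm]
  · refine ⟨(γ + 1)⁻¹, by positivity, fun N => ?_⟩
    rw [inv_mul_eq_div, le_div_iff₀' hγ1]
    induction N with
    | zero => simp [Real.zero_rpow hγ1.ne']
    | succ N ih =>
      have hincr := rpow_add_mul_rpow_sub_one_le hγ1.le (by linarith) N
      rw [add_sub_cancel_right] at hincr
      rw [Finset.sum_Icc_succ_top N.succ_pos, mul_add]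
      push_cast
      linarith

theorem exists_rpowSum_le_rpow (hγ : -1 < γ) :
    ∃ C : ℝ, 0 < C ∧ ∀ x, 0 ≤ x → rpowSum γ x ≤ C * x ^ (γ + 1) := by
  obtain ⟨C, hC, hle⟩ := exists_rpowSum_natCast_le hγ
  refine ⟨C, hC, fun x hx => ?_⟩
  have hfloor := hle ⌊x⌋₊
  rw [rpowSum, Nat.floor_natCast] at hfloor
  refine hfloor.trans ?_
  gcongr
  · linarith
  · exact Nat.floor_le hx

theorem two_rpow_neg_abs_mul_rpow_le {y : ℝ} (hx : 0 < x) (hxy : x / 2 ≤ y) (hyx : y ≤ 2 * x) :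
    2 ^ (-|γ|) * x ^ γ ≤ y ^ γ := by
  rcases le_total 0 γ with hγ | hγ
  · rw [abs_of_nonneg hγ, Real.rpow_neg two_pos.le, inv_mul_eq_div,
      ← Real.div_rpow hx.le two_pos.le]
    gcongr
  · rw [abs_of_nonpos hγ, neg_neg, ← Real.mul_rpow two_pos.le hx.le]
    exact Real.rpow_le_rpow_of_nonpos (by linarith) hyx hγ

theorem div_four_le_card_Ioc_floor (hx : 2 ≤ x) :
    x / 4 ≤ (Finset.Ioc ⌊x / 2⌋₊ ⌊x⌋₊).card := by
  have hlt : ⌊x / 2⌋₊ + 1 ≤ ⌊x⌋₊ := by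
    rw [← Nat.floor_add_one (by linarith)]
    exact Nat.floor_mono (by linarith)
  have hlt' : (⌊x / 2⌋₊ : ℝ) + 1 ≤ ⌊x⌋₊ := by exact_mod_cast hlt
  rw [Nat.card_Ioc, Nat.cast_sub (by lia)]
  linarith [Nat.lt_floor_add_one x, Nat.floor_le (a := x / 2) (by linarith)]

theorem exists_rpow_le_sum_Icc (γ : ℝ) :
    ∃ c : ℝ, 0 < c ∧ ∀ (x : ℝ) (i : ℕ), 1 ≤ i → 2 * (i : ℝ) ≤ x →
      c * x ^ (γ + 1) ≤ ∑ n ∈ Finset.Icc i ⌊x⌋₊, (n : ℝ) ^ γ := by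
  refine ⟨2 ^ (-|γ|) / 4, by positivity, fun x i hi hx => ?_⟩
  have hi1 : (1 : ℝ) ≤ i := by exact_mod_cast hi
  have hx0 : 0 < x := by linarith
  have hsub : Finset.Ioc ⌊x / 2⌋₊ ⌊x⌋₊ ⊆ Finset.Icc i ⌊x⌋₊ := fun n hn => by
    have hin : i ≤ ⌊x / 2⌋₊ := Nat.le_floor (by linarith)
    rw [Finset.mem_Ioc] at hn
    exact Finset.mem_Icc.2 ⟨by lia, hn.2⟩
  have hterm : ∀ n ∈ Finset.Ioc ⌊x / 2⌋₊ ⌊x⌋₊, 2 ^ (-|γ|) * x ^ γ ≤ (n : ℝ) ^ γ := fun n hn => by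
    rw [Finset.mem_Ioc] at hn
    have hnx : (n : ℝ) ≤ x := (Nat.le_floor_iff hx0.le).1 hn.2
    exact two_rpow_neg_abs_mul_rpow_le hx0 (Nat.lt_of_floor_lt hn.1).le (by linarith)
  calc 2 ^ (-|γ|) / 4 * x ^ (γ + 1) = x / 4 * (2 ^ (-|γ|) * x ^ γ) := by
        rw [Real.rpow_add_one hx0.ne']
        ring
    _ ≤ (Finset.Ioc ⌊x / 2⌋₊ ⌊x⌋₊).card * (2 ^ (-|γ|) * x ^ γ) := by
        gcongr
        exact div_four_le_card_Ioc_floor (by linarith)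
    _ ≤ ∑ n ∈ Finset.Ioc ⌊x / 2⌋₊ ⌊x⌋₊, (n : ℝ) ^ γ := by
        rw [← nsmul_eq_mul]
        exact Finset.card_nsmul_le_sum _ _ _ hterm
    _ ≤ ∑ n ∈ Finset.Icc i ⌊x⌋₊, (n : ℝ) ^ γ :=
        Finset.sum_le_sum_of_subset_of_nonneg hsub fun _ _ _ => by positivity

theorem exists_rpow_le_rpowSum (γ : ℝ) :
    ∃ c : ℝ, 0 < c ∧ ∀ x, 2 ≤ x → c * x ^ (γ + 1) ≤ rpowSum γ x := by
  obtain ⟨c, hc, hle⟩ := exists_rpow_le_sum_Icc γ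
  exact ⟨c, hc, fun x hx => hle x 1 le_rfl (by simpa using hx)⟩

end PowerSums

/-- The order of growth of the total weight `atomCount r p β T` of the atoms below `T`; the
parameter `d` accounts for a rescaling of the atoms. -/
noncomputable def growthSum (r p β d T : ℝ) : ℝ :=
  T ^ ((r - 1) / (p + β)) * rpowSum (β * ((r - 1) / (p + β))) ((T / d) ^ (1 / p))

/-- `f` and `growthSum` are of the same order of growth. -/
structure GrowthComparable (r p β : ℝ) (f : ℝ → ℝ) : Prop where
  growthSum_le : ∀ d, 0 < d → ∃ C : ℝ, 0 ≤ C ∧ ∀ T, 0 < T → growthSum r p β d T ≤ C * f T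
  le_growthSum : ∀ d, 0 < d → ∃ C : ℝ, 0 ≤ C ∧ ∃ T₀, 0 < T₀ ∧
    ∀ T, T₀ ≤ T → f T ≤ C * growthSum r p β d T

section Growth

variable {r p β d T : ℝ}

theorem growthSum_nonneg (hT : 0 ≤ T) : 0 ≤ growthSum r p β d T :=
  mul_nonneg (by positivity) (rpowSum_nonneg _ _)

theorem growthSum_div {c : ℝ} (hc : 0 < c) (hT : 0 < T) :
    growthSum r p β d (T / c) = (c ^ ((r - 1) / (p + β)))⁻¹ * growthSum r p β (c * d) T := by
  rw [growthSum, growthSum, Real.div_rpow hT.le hc.le, div_div]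
  ring

theorem growthComparable_rpow_of_lt (hr : 1 < r) (hp : 0 < p) (hβ : 0 < β + p) (h : β < -p / r) :
    GrowthComparable r p β fun x => x ^ ((r - 1) / (p + β)) := by
  have hpβ : 0 < p + β := by linarith
  have hγ : β * ((r - 1) / (p + β)) < -1 := by
    rw [lt_div_iff₀ (by linarith)] at h
    rw [← mul_div_assoc, div_lt_iff₀ hpβ]
    linarith
  refine ⟨fun d _ => ?_, fun d hd => ⟨1, zero_le_one, d, hd, fun T hT => ?_⟩⟩
  · obtain ⟨C, hC, hle⟩ := exists_rpowSum_le hγ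
    refine ⟨C, hC, fun T hT => ?_⟩
    rw [growthSum, mul_comm]
    gcongr
    exact hle _
  · have hT0 := hd.trans_le hT
    rw [one_mul, growthSum]
    exact le_mul_of_one_le_right (by positivity)
      (one_le_rpowSum (Real.one_le_rpow ((one_le_div hd).2 hT) (by positivity)))

theorem rpow_mul_rpow_div_rpow (hp : p ≠ 0) (hpβ : p + β ≠ 0) (hd : 0 < d) (hT : 0 < T) :
    T ^ ((r - 1) / (p + β)) * ((T / d) ^ (1 / p)) ^ (β * ((r - 1) / (p + β)) + 1)
      = (d ^ (1 / p * (β * ((r - 1) / (p + β)) + 1)))⁻¹ * T ^ (r / p) := by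
  have hexp : (r - 1) / (p + β) + 1 / p * (β * ((r - 1) / (p + β)) + 1) = r / p := by
    field_simp
    ring
  rw [← Real.rpow_mul (by positivity), Real.div_rpow hT.le hd.le, ← hexp, Real.rpow_add hT]
  ring

theorem growthComparable_rpow_of_gt (hr : 1 < r) (hp : 0 < p) (hβ : 0 < β + p) (h : -p / r < β) :
    GrowthComparable r p β fun x => x ^ (r / p) := by
  have hpβ : 0 < p + β := by linarith
  have hγ : -1 < β * ((r - 1) / (p + β)) := by
    rw [div_lt_iff₀ (by linarith)] at h
    rw [← mul_div_assoc, lt_div_iff₀ hpβ]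
    linarith
  have hscale := fun d T hd hT =>
    rpow_mul_rpow_div_rpow (r := r) (d := d) (T := T) hp.ne' hpβ.ne' hd hT
  set γ := β * ((r - 1) / (p + β)) with hγ_def
  refine ⟨fun d hd => ?_, fun d hd => ?_⟩
  · obtain ⟨C, hC, hle⟩ := exists_rpowSum_le_rpow hγ
    refine ⟨C * (d ^ (1 / p * (γ + 1)))⁻¹, by positivity, fun T hT => ?_⟩
    calc growthSum r p β d T
        ≤ T ^ ((r - 1) / (p + β)) * (C * ((T / d) ^ (1 / p)) ^ (γ + 1)) := by
          rw [growthSum, ← hγ_def]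
          gcongr
          exact hle _ (by positivity)
      _ = C * (d ^ (1 / p * (γ + 1)))⁻¹ * T ^ (r / p) := by
          rw [mul_left_comm, hscale d T hd hT, mul_assoc]
  · obtain ⟨c, hc, hle⟩ := exists_rpow_le_rpowSum γ
    refine ⟨d ^ (1 / p * (γ + 1)) * c⁻¹, by positivity, d * 2 ^ p, by positivity, fun T hT => ?_⟩
    have hT0 : 0 < T := lt_of_lt_of_le (by positivity) hT
    have hlarge : 2 ≤ (T / d) ^ (1 / p) := by
      rwa [one_div, Real.le_rpow_inv_iff_of_pos two_pos.le (by positivity) hp, le_div_iff₀' hd]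
    calc T ^ (r / p) = d ^ (1 / p * (γ + 1)) * c⁻¹
          * (T ^ ((r - 1) / (p + β)) * (c * ((T / d) ^ (1 / p)) ^ (γ + 1))) := by
          rw [mul_left_comm (T ^ _) c, hscale d T hd hT0]
          field_simp
      _ ≤ d ^ (1 / p * (γ + 1)) * c⁻¹ * growthSum r p β d T := by
          rw [growthSum, ← hγ_def]
          gcongr
          exact hle _ hlarge

theorem exists_rpowSum_neg_one_le_log {θ : ℝ} (hθ : 0 < θ) (hd : 0 < d) :
    ∃ C : ℝ, 0 ≤ C ∧ ∀ T, 0 < T → rpowSum (-1) ((T / d) ^ θ) ≤ C * Real.log (1 + T) := by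
  have hlogd : 0 < Real.log (1 + d) := Real.log_pos (by linarith)
  refine ⟨θ + (1 + θ * |Real.log d|) / Real.log (1 + d), by positivity, fun T hT => ?_⟩
  have hlogT : 0 ≤ Real.log (1 + T) := Real.log_nonneg (by linarith)
  rcases lt_or_ge T d with hTd | hTd
  · rw [rpowSum_eq_zero (Real.rpow_lt_one (by positivity) ((div_lt_one hd).2 hTd) hθ)]
    positivity
  · have hconst : 1 + θ * |Real.log d|
        ≤ (1 + θ * |Real.log d|) / Real.log (1 + d) * Real.log (1 + T) := by
      rw [div_mul_eq_mul_div, le_div_iff₀ hlogd]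
      gcongr
    calc rpowSum (-1) ((T / d) ^ θ) ≤ 1 + Real.log ((T / d) ^ θ) := by
          rw [rpowSum_neg_one]
          exact harmonic_floor_le_one_add_log _
            (Real.one_le_rpow ((one_le_div hd).2 hTd) hθ.le)
      _ = 1 + θ * (Real.log T - Real.log d) := by
          rw [Real.log_rpow (by positivity), Real.log_div hT.ne' hd.ne']
      _ ≤ 1 + θ * (Real.log (1 + T) + |Real.log d|) := by
          gcongr
          linarith [Real.log_le_log hT (by linarith : T ≤ 1 + T), neg_abs_le (Real.log d)]
      _ ≤ (θ + (1 + θ * |Real.log d|) / Real.log (1 + d)) * Real.log (1 + T) := by linarith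

theorem log_le_rpowSum_neg_one {θ : ℝ} (hθ : 0 < θ) (hd : 0 < d) (hT1 : 1 ≤ T)
    (hTd : 2 * d ^ 2 ≤ T) : Real.log (1 + T) ≤ 2 / θ * rpowSum (-1) ((T / d) ^ θ) := by
  have : 0 < T := by linarith
  have hsq : 1 + T ≤ (T / d) ^ 2 := by
    rw [div_pow, le_div_iff₀ (by positivity)]
    nlinarith
  calc Real.log (1 + T) ≤ Real.log ((T / d) ^ 2) := Real.log_le_log (by linarith) hsq
    _ = 2 / θ * Real.log ((T / d) ^ θ) := by
        rw [Real.log_pow, Real.log_rpow (by positivity)]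
        push_cast
        field_simp
    _ ≤ 2 / θ * rpowSum (-1) ((T / d) ^ θ) := by
        rw [rpowSum_neg_one]
        gcongr
        exact log_le_harmonic_floor _ (by positivity)

theorem growthComparable_rpow_mul_log (hr : 1 < r) (hp : 0 < p) (h : β = -p / r) :
    GrowthComparable r p β fun x => x ^ (r / p) * Real.log (1 + x) := by
  have hs : (r - 1) / (p + β) = r / p := by
    have hpβ : p + β = p * (r - 1) / r := by
      rw [h]
      field_simp
      ring
    have hr1 : r - 1 ≠ 0 := by linarith
    rw [hpβ]
    field_simp
  have hγ : β * (r / p) = -1 := by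
    rw [h]
    field_simp
  have hθ : 0 < 1 / p := by positivity
  refine ⟨fun d hd => ?_, fun d hd => ⟨2 / (1 / p), by positivity, max 1 (2 * d ^ 2), by positivity,
    fun T hT => ?_⟩⟩
  · obtain ⟨C, hC, hle⟩ := exists_rpowSum_neg_one_le_log hθ hd
    refine ⟨C, hC, fun T hT => ?_⟩
    rw [growthSum, hs, hγ, mul_left_comm]
    gcongr
    exact hle T hT
  · obtain ⟨hT1, hTd⟩ := max_le_iff.1 hT
    rw [growthSum, hs, hγ, mul_left_comm]
    gcongr
    exact log_le_rpowSum_neg_one hθ hd hT1 hTd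

end Growth

/-- The size of `|X i|` at which a term with weight `(i / n) ^ β * (1 / n) ^ p` reaches `1`. -/
noncomputable def jumpLevel (p β : ℝ) (n i : ℕ) : ℝ :=
  (n : ℝ) ^ (p + β) * (i : ℝ) ^ (-β)

/-- The mass `n ^ (r - 2)` attached to the pair `(n, i)`; only pairs with `1 ≤ i ≤ n` count. -/
noncomputable def atomWeight (r : ℝ) (n i : ℕ) : ℝ≥0∞ :=
  if 1 ≤ i ∧ i ≤ n then ENNReal.ofReal ((n : ℝ) ^ (r - 2)) else 0

/-- The total mass of the pairs whose jump level is at most `U`. -/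
noncomputable def atomCount (r p β U : ℝ) : ℝ≥0∞ :=
  ∑' i : ℕ, ∑' n : ℕ, if jumpLevel p β n i ≤ U then atomWeight r n i else 0

/-- For fixed `i`, the jump level of `(n, i)` is at most `U` exactly for `n ≤ cutoff p β U i`. -/
noncomputable def cutoff (p β U : ℝ) (i : ℕ) : ℝ :=
  (U * (i : ℝ) ^ β) ^ (1 / (p + β))

section Counting

variable {r p β U : ℝ} {n i : ℕ}

theorem jumpLevel_nonneg (p β : ℝ) (n i : ℕ) : 0 ≤ jumpLevel p β n i := by
  unfold jumpLevel
  positivity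

theorem jumpLevel_pos (hn : 1 ≤ n) (hi : 1 ≤ i) : 0 < jumpLevel p β n i := by
  have : (0 : ℝ) < n := by exact_mod_cast hn
  have : (0 : ℝ) < i := by exact_mod_cast hi
  unfold jumpLevel
  positivity

theorem jumpLevel_le_iff (hβ : 0 < β + p) (hU : 0 < U) (hi : 1 ≤ i) :
    jumpLevel p β n i ≤ U ↔ (n : ℝ) ≤ cutoff p β U i := by
  have hi0 : (0 : ℝ) < i := by exact_mod_cast hi
  rw [jumpLevel, cutoff, Real.rpow_neg hi0.le, ← div_eq_mul_inv, div_le_iff₀ (by positivity),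
    one_div, Real.le_rpow_inv_iff_of_pos (by positivity) (by positivity) (by linarith)]

theorem mul_le_cutoff_iff {κ : ℝ} (hp : 0 < p) (hβ : 0 < β + p) (hκ : 0 < κ) (hU : 0 < U)
    (hi : 1 ≤ i) : κ * i ≤ cutoff p β U i ↔ (i : ℝ) ≤ (U / κ ^ (p + β)) ^ (1 / p) := by
  have hi0 : (0 : ℝ) < i := by exact_mod_cast hi
  rw [cutoff, one_div, one_div, Real.le_rpow_inv_iff_of_pos (by positivity) (by positivity)
    (by linarith), Real.le_rpow_inv_iff_of_pos (by positivity) (by positivity) hp,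
    le_div_iff₀ (by positivity), Real.mul_rpow hκ.le hi0.le, Real.rpow_add hi0, ← mul_assoc,
    mul_le_mul_iff_left₀ (by positivity), mul_comm]

theorem cutoff_rpow_sub_one (hU : 0 < U) :
    cutoff p β U i ^ (r - 1) = U ^ ((r - 1) / (p + β)) * (i : ℝ) ^ (β * ((r - 1) / (p + β))) := by
  rw [cutoff, ← Real.rpow_mul (by positivity), Real.mul_rpow hU.le (by positivity),
    ← Real.rpow_mul i.cast_nonneg]
  congr 2 <;> ring

theorem tsum_atomWeight_jumpLevel_le (hβ : 0 < β + p) (hU : 0 < U) (hi : 1 ≤ i) :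
    (∑' n : ℕ, if jumpLevel p β n i ≤ U then atomWeight r n i else 0)
      = ENNReal.ofReal (∑ n ∈ Finset.Icc i ⌊cutoff p β U i⌋₊, (n : ℝ) ^ (r - 2)) := by
  have hcut : 0 ≤ cutoff p β U i := by unfold cutoff; positivity
  rw [ENNReal.ofReal_sum_of_nonneg fun _ _ => by positivity, tsum_eq_sum fun n hn => ?_]
  · refine Finset.sum_congr rfl fun n hn => ?_
    obtain ⟨hin, hnU⟩ := Finset.mem_Icc.1 hn
    rw [if_pos ((jumpLevel_le_iff hβ hU hi).2 ((Nat.le_floor_iff hcut).1 hnU)), atomWeight,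
      if_pos ⟨hi, hin⟩]
  · by_cases hin : i ≤ n
    · exact if_neg fun hle =>
        hn (Finset.mem_Icc.2 ⟨hin, Nat.le_floor ((jumpLevel_le_iff hβ hU hi).1 hle)⟩)
    · simp [atomWeight, hin]

theorem atomCount_eq_sum (hp : 0 < p) (hβ : 0 < β + p) (hU : 0 < U) :
    atomCount r p β U = ENNReal.ofReal (∑ i ∈ Finset.Icc 1 ⌊U ^ (1 / p)⌋₊,
      ∑ n ∈ Finset.Icc i ⌊cutoff p β U i⌋₊, (n : ℝ) ^ (r - 2)) := by
  rw [ENNReal.ofReal_sum_of_nonneg fun _ _ => Finset.sum_nonneg fun _ _ => by positivity,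
    atomCount, tsum_eq_sum fun i hi => ?_]
  · exact Finset.sum_congr rfl fun i hi =>
      tsum_atomWeight_jumpLevel_le hβ hU (Finset.mem_Icc.1 hi).1
  · rcases Nat.eq_zero_or_pos i with rfl | hi1
    · simp [atomWeight]
    · rw [tsum_atomWeight_jumpLevel_le hβ hU hi1, Finset.Icc_eq_empty, Finset.sum_empty,
        ENNReal.ofReal_zero]
      intro hle
      have hcut := (Nat.le_floor_iff (by unfold cutoff; positivity)).1 hle
      have hiU := (mul_le_cutoff_iff hp hβ one_pos hU hi1).1 (by simpa using hcut)
      rw [Real.one_rpow, div_one] at hiU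
      exact hi (Finset.mem_Icc.2 ⟨hi1, Nat.le_floor hiU⟩)

theorem exists_atomCount_le_growthSum (hr : 1 < r) (hp : 0 < p) (hβ : 0 < β + p) :
    ∃ C : ℝ, 0 ≤ C ∧ ∀ U, 0 < U →
      atomCount r p β U ≤ ENNReal.ofReal (C * growthSum r p β 1 U) := by
  obtain ⟨C, hC, hle⟩ := exists_rpowSum_le_rpow (γ := r - 2) (by linarith)
  refine ⟨C, hC.le, fun U hU => ?_⟩
  rw [atomCount_eq_sum hp hβ hU, growthSum, rpowSum, div_one, ← mul_assoc, Finset.mul_sum]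
  refine ENNReal.ofReal_le_ofReal (Finset.sum_le_sum fun i hi => ?_)
  calc ∑ n ∈ Finset.Icc i ⌊cutoff p β U i⌋₊, (n : ℝ) ^ (r - 2)
      ≤ rpowSum (r - 2) (cutoff p β U i) :=
        Finset.sum_le_sum_of_subset_of_nonneg
          (Finset.Icc_subset_Icc_left (Finset.mem_Icc.1 hi).1) fun _ _ _ => by positivity
    _ ≤ C * cutoff p β U i ^ (r - 2 + 1) := hle _ (by unfold cutoff; positivity)
    _ = C * U ^ ((r - 1) / (p + β)) * (i : ℝ) ^ (β * ((r - 1) / (p + β))) := by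
        rw [show r - 2 + 1 = r - 1 by ring, cutoff_rpow_sub_one hU, mul_assoc]

theorem exists_growthSum_le_atomCount (hp : 0 < p) (hβ : 0 < β + p) :
    ∃ c : ℝ, 0 < c ∧ ∀ U, 0 < U →
      ENNReal.ofReal (c * growthSum r p β (2 ^ (p + β)) U) ≤ atomCount r p β U := by
  obtain ⟨c, hc, hle⟩ := exists_rpow_le_sum_Icc (r - 2)
  refine ⟨c, hc, fun U hU => ?_⟩
  have hpβ : 0 < p + β := by linarith
  have htwo : U / 2 ^ (p + β) ≤ U :=
    div_le_self hU.le (Real.one_le_rpow one_le_two hpβ.le)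
  rw [atomCount_eq_sum hp hβ hU, growthSum, rpowSum, ← mul_assoc, Finset.mul_sum]
  refine ENNReal.ofReal_le_ofReal ?_
  calc ∑ i ∈ Finset.Icc 1 ⌊(U / 2 ^ (p + β)) ^ (1 / p)⌋₊,
        c * U ^ ((r - 1) / (p + β)) * (i : ℝ) ^ (β * ((r - 1) / (p + β)))
      ≤ ∑ i ∈ Finset.Icc 1 ⌊(U / 2 ^ (p + β)) ^ (1 / p)⌋₊,
        ∑ n ∈ Finset.Icc i ⌊cutoff p β U i⌋₊, (n : ℝ) ^ (r - 2) := by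
        refine Finset.sum_le_sum fun i hi => ?_
        obtain ⟨hi1, hiU⟩ := Finset.mem_Icc.1 hi
        rw [mul_assoc, ← cutoff_rpow_sub_one hU, show r - 1 = r - 2 + 1 by ring]
        exact hle _ i hi1 ((mul_le_cutoff_iff hp hβ two_pos hU hi1).2
          ((Nat.le_floor_iff (by positivity)).1 hiU))
    _ ≤ ∑ i ∈ Finset.Icc 1 ⌊U ^ (1 / p)⌋₊,
        ∑ n ∈ Finset.Icc i ⌊cutoff p β U i⌋₊, (n : ℝ) ^ (r - 2) :=
        Finset.sum_le_sum_of_subset_of_nonneg (Finset.Icc_subset_Icc_right (by gcongr))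
          fun _ _ _ => Finset.sum_nonneg fun _ _ => by positivity

theorem GrowthComparable.exists_atomCount_le {f : ℝ → ℝ} (hf : GrowthComparable r p β f)
    (hr : 1 < r) (hp : 0 < p) (hβ : 0 < β + p) {c : ℝ} (hc : 0 < c) :
    ∃ C : ℝ, 0 ≤ C ∧ ∀ T, 0 < T → atomCount r p β (T / c) ≤ ENNReal.ofReal (C * f T) := by
  obtain ⟨C₁, hC₁, hcount⟩ := exists_atomCount_le_growthSum hr hp hβ
  obtain ⟨C₂, hC₂, hgrowth⟩ := hf.growthSum_le (c * 1) (by positivity)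
  refine ⟨C₁ * (c ^ ((r - 1) / (p + β)))⁻¹ * C₂, by positivity, fun T hT => ?_⟩
  refine (hcount _ (by positivity)).trans (ENNReal.ofReal_le_ofReal ?_)
  rw [growthSum_div hc hT, ← mul_assoc, mul_assoc (C₁ * _)]
  gcongr
  exact hgrowth T hT

theorem GrowthComparable.exists_le_growthSum_add_one {f : ℝ → ℝ} (hf : GrowthComparable r p β f)
    (hmono : MonotoneOn f (Set.Ici 0)) {d : ℝ} (hd : 0 < d) :
    ∃ C : ℝ, 0 ≤ C ∧ ∀ T, 0 < T → f T ≤ C * (growthSum r p β d T + 1) := by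
  obtain ⟨C, hC, T₀, hT₀, hle⟩ := hf.le_growthSum d hd
  refine ⟨max C (f T₀), hC.trans (le_max_left _ _), fun T hT => ?_⟩
  have hg := growthSum_nonneg (r := r) (p := p) (β := β) (d := d) hT.le
  rcases le_total T₀ T with h | h
  · calc f T ≤ C * growthSum r p β d T := hle T h
      _ ≤ max C (f T₀) * (growthSum r p β d T + 1) := by
        gcongr
        · exact le_max_left _ _
        · linarith
  · calc f T ≤ f T₀ := hmono hT.le hT₀.le h
      _ ≤ max C (f T₀) := le_max_right _ _
      _ ≤ max C (f T₀) * (growthSum r p β d T + 1) :=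
        le_mul_of_one_le_right (hC.trans (le_max_left _ _)) (by linarith)

theorem GrowthComparable.exists_le_atomCount {f : ℝ → ℝ} (hf : GrowthComparable r p β f)
    (hmono : MonotoneOn f (Set.Ici 0)) (hp : 0 < p) (hβ : 0 < β + p) {c : ℝ} (hc : 0 < c) :
    ∃ C : ℝ, 0 ≤ C ∧ ∀ T, 0 < T →
      ENNReal.ofReal (f T) ≤ ENNReal.ofReal C * (atomCount r p β (T / c) + 1) := by
  obtain ⟨b, hb, hcount⟩ := exists_growthSum_le_atomCount (r := r) hp hβ
  obtain ⟨C, hC, hgrowth⟩ := hf.exists_le_growthSum_add_one hmono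
    (d := c * 2 ^ (p + β)) (by positivity)
  set s := c ^ ((r - 1) / (p + β))
  have hs : 0 < s := by positivity
  refine ⟨C * max (s / b) 1, by positivity, fun T hT => ?_⟩
  set G := growthSum r p β (2 ^ (p + β)) (T / c)
  have hG : 0 ≤ G := growthSum_nonneg (by positivity)
  have hscale : growthSum r p β (c * 2 ^ (p + β)) T = s / b * (b * G) := by
    rw [show G = s⁻¹ * _ from growthSum_div hc hT]
    field_simp
  calc ENNReal.ofReal (f T) ≤ ENNReal.ofReal (C * max (s / b) 1 * (b * G + 1)) := by
        refine ENNReal.ofReal_le_ofReal ((hgrowth T hT).trans ?_)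
        rw [hscale, mul_assoc, mul_add (max _ _), mul_one]
        gcongr
        · exact le_max_left _ _
        · exact le_max_right _ _
    _ = ENNReal.ofReal (C * max (s / b) 1) * (ENNReal.ofReal (b * G) + 1) := by
        rw [ENNReal.ofReal_mul (by positivity), ENNReal.ofReal_add (by positivity) zero_le_one,
          ENNReal.ofReal_one]
    _ ≤ _ := by
        gcongr
        exact hcount _ (by positivity)

end Counting

/-- `f` restricts to an increasing homeomorphism of `[0, ∞)` onto itself. -/
structure IsIncreasingHomeo (f : ℝ → ℝ) : Prop where
  strictMonoOn : StrictMonoOn f (Set.Ici 0)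
  continuousOn : ContinuousOn f (Set.Ici 0)
  map_zero : f 0 = 0
  tendsto_atTop : Filter.Tendsto f Filter.atTop Filter.atTop

namespace IsIncreasingHomeo

variable {f g : ℝ → ℝ} {x y : ℝ}

theorem pos (hf : IsIncreasingHomeo f) (hx : 0 < x) : 0 < f x := by
  simpa [hf.map_zero] using hf.strictMonoOn (Set.mem_Ici.2 le_rfl) hx.le hx

theorem nonneg (hf : IsIncreasingHomeo f) (hx : 0 ≤ x) : 0 ≤ f x := by
  simpa [hf.map_zero] using hf.strictMonoOn.monotoneOn (Set.mem_Ici.2 le_rfl) hx hx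

theorem exists_eq_of_pos (hf : IsIncreasingHomeo f) (hy : 0 < y) : ∃ x, 0 < x ∧ f x = y := by
  obtain ⟨b, hyb, hb⟩ :=
    ((hf.tendsto_atTop.eventually_ge_atTop y).and (Filter.eventually_ge_atTop 0)).exists
  obtain ⟨x, hx, rfl⟩ := intermediate_value_Icc hb (hf.continuousOn.mono Set.Icc_subset_Ici_self)
    ⟨hf.map_zero.trans_le hy.le, hyb⟩
  refine ⟨x, hx.1.lt_of_ne ?_, rfl⟩
  rintro rfl
  exact hy.ne' hf.map_zero

theorem setOf_comp_lt_comp_abs (hf : IsIncreasingHomeo f) {Ω : Type*} (X : Ω → ℝ) (hx : 0 ≤ x) :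
    {ω | f x < f |X ω|} = {ω | x < |X ω|} :=
  Set.ext fun ω => hf.strictMonoOn.lt_iff_lt hx (Set.mem_Ici.2 (abs_nonneg (X ω)))

theorem rpow {s : ℝ} (hs : 0 < s) : IsIncreasingHomeo fun x => x ^ s where
  strictMonoOn _ hx _ _ hxy := Real.rpow_lt_rpow hx hxy hs
  continuousOn := (Real.continuous_rpow_const hs.le).continuousOn
  map_zero := Real.zero_rpow hs.ne'
  tendsto_atTop := tendsto_rpow_atTop hs

theorem log_one_add : IsIncreasingHomeo fun x => Real.log (1 + x) where
  strictMonoOn x (hx : 0 ≤ x) _ _ hxy := Real.log_lt_log (by linarith) (by linarith)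
  continuousOn := ContinuousOn.log (by fun_prop) fun x (hx : 0 ≤ x) => by linarith
  map_zero := by simp
  tendsto_atTop := Real.tendsto_log_atTop.comp
    (Filter.tendsto_atTop_add_const_left _ _ Filter.tendsto_id)

theorem mul (hf : IsIncreasingHomeo f) (hg : IsIncreasingHomeo g) :
    IsIncreasingHomeo fun x => f x * g x where
  strictMonoOn _ hx _ hy hxy := mul_lt_mul'' (hf.strictMonoOn hx hy hxy)
    (hg.strictMonoOn hx hy hxy) (hf.nonneg hx) (hg.nonneg hx)
  continuousOn := hf.continuousOn.mul hg.continuousOn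
  map_zero := by rw [hf.map_zero, zero_mul]
  tendsto_atTop := hf.tendsto_atTop.atTop_mul_atTop₀ hg.tendsto_atTop

end IsIncreasingHomeo

/-! ### Choquet integrals as weighted series -/

section LowerSets

variable {μ ν : Measure ℝ} {C : ℝ}

theorem measure_le_of_isLowerSet
    (hμν : ∀ y, μ (Set.Iic y) ≤ ENNReal.ofReal C * (ν (Set.Iio y) + 1)) {L : Set ℝ}
    (hL : IsLowerSet L) : μ L ≤ ENNReal.ofReal C * (ν L + 1) := by
  rcases L.eq_empty_or_nonempty with rfl | hne
  · simp
  by_cases hb : BddAbove L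
  · have hsub : L ⊆ Set.Iic (sSup L) := fun x hx => le_csSup hb hx
    have hsup : Set.Iio (sSup L) ⊆ L := fun x hx => by
      obtain ⟨y, hy, hxy⟩ := exists_lt_of_lt_csSup hne hx
      exact hL hxy.le hy
    refine (measure_mono hsub).trans ((hμν _).trans ?_)
    gcongr
  · have huniv : L = Set.univ := Set.eq_univ_of_forall fun x => by
      obtain ⟨y, hy, hxy⟩ := not_bddAbove_iff.1 hb x
      exact hL hxy.le hy
    rw [huniv]
    refine le_of_tendsto' (tendsto_measure_Iic_atTop μ) fun y => (hμν y).trans ?_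
    gcongr
    exact Set.subset_univ _

theorem lintegral_ofReal_eq_setLIntegral_Ioo (μ : Measure ℝ) {h : ℝ → ℝ} (hh : Measurable h)
    (h0 : ∀ x, 0 ≤ h x) (h1 : ∀ x, h x ≤ 1) :
    ∫⁻ x, ENNReal.ofReal (h x) ∂μ = ∫⁻ t in Set.Ioo (0 : ℝ) 1, μ {x | t < h x} := by
  have htail : ∀ t, μ {x | t < h x} = (Set.Iio 1).indicator (fun t => μ {x | t < h x}) t := by
    intro t
    rcases lt_or_ge t 1 with ht | ht
    · rw [Set.indicator_of_mem (Set.mem_Iio.2 ht)]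
    · rw [Set.indicator_of_notMem (by simpa using ht),
        Set.eq_empty_of_forall_notMem (s := {x | t < h x}) fun x hx => hx.not_ge ((h1 x).trans ht),
        measure_empty]
  rw [lintegral_eq_lintegral_meas_lt μ (ae_of_all _ h0) hh.aemeasurable, lintegral_congr htail,
    setLIntegral_indicator measurableSet_Iio, Set.inter_comm, Set.Ioi_inter_Iio]

theorem lintegral_le_of_measure_Iic_le
    (hμν : ∀ y, μ (Set.Iic y) ≤ ENNReal.ofReal C * (ν (Set.Iio y) + 1)) {h : ℝ → ℝ}
    (hh : Antitone h) (h0 : ∀ x, 0 ≤ h x) (h1 : ∀ x, h x ≤ 1) :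
    ∫⁻ x, ENNReal.ofReal (h x) ∂μ
      ≤ ENNReal.ofReal C * (∫⁻ x, ENNReal.ofReal (h x) ∂ν + 1) := by
  have hlow : ∀ t, IsLowerSet {x | t < h x} := fun t x y hyx hx => lt_of_lt_of_le hx (hh hyx)
  rw [lintegral_ofReal_eq_setLIntegral_Ioo μ hh.measurable h0 h1,
    lintegral_ofReal_eq_setLIntegral_Ioo ν hh.measurable h0 h1]
  calc ∫⁻ t in Set.Ioo (0 : ℝ) 1, μ {x | t < h x}
      ≤ ∫⁻ t in Set.Ioo (0 : ℝ) 1, ENNReal.ofReal C * (ν {x | t < h x} + 1) :=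
        lintegral_mono fun t => measure_le_of_isLowerSet hμν (hlow t)
    _ = ENNReal.ofReal C * ((∫⁻ t in Set.Ioo (0 : ℝ) 1, ν {x | t < h x}) + 1) := by
        rw [lintegral_const_mul' _ _ ENNReal.ofReal_ne_top, lintegral_add_right _ measurable_const]
        simp

theorem ofReal_mul_le_setLIntegral_Ioi {h : ℝ → ℝ≥0∞} (hh : Antitone h) (y : ℝ) :
    ENNReal.ofReal y * h y ≤ ∫⁻ x in Set.Ioi (0 : ℝ), h x := by
  calc ENNReal.ofReal y * h y = ∫⁻ _ in Set.Ioo (0 : ℝ) y, h y := by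
        rw [setLIntegral_const, Real.volume_Ioo, sub_zero, mul_comm]
    _ ≤ ∫⁻ x in Set.Ioo (0 : ℝ) y, h x :=
        setLIntegral_mono' measurableSet_Ioo fun x hx => hh hx.2.le
    _ ≤ ∫⁻ x in Set.Ioi (0 : ℝ), h x := lintegral_mono_set Set.Ioo_subset_Ioi_self

end LowerSets

/-- The weighted series `∑ₙ n ^ (r - 2) ∑_{i ≤ n} g (c * jumpLevel p β n i)`. -/
noncomputable def tailSeries (r p β c : ℝ) (g : ℝ → ℝ≥0∞) : ℝ≥0∞ :=
  ∑' n : ℕ, ∑' i : ℕ, atomWeight r n i * g (c * jumpLevel p β n i)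

/-- The discrete measure with mass `atomWeight r n i` at the image under `f` of
`c * jumpLevel p β n i`, for all pairs `(n, i)`. -/
noncomputable def atomMeasure (r p β c : ℝ) (f : ℝ → ℝ) : Measure ℝ :=
  Measure.sum fun k : ℕ × ℕ =>
    atomWeight r k.2 k.1 • Measure.dirac (f (c * jumpLevel p β k.2 k.1))

section AtomMeasure

variable {r p β c : ℝ} {f : ℝ → ℝ}

theorem lintegral_atomMeasure {h : ℝ → ℝ≥0∞} (hh : Measurable h) :
    ∫⁻ x, h x ∂atomMeasure r p β c f = tailSeries r p β c (fun t => h (f t)) := by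
  rw [atomMeasure, lintegral_sum_measure, tailSeries, ENNReal.tsum_comm, ENNReal.tsum_prod']
  simp only [lintegral_smul_measure, lintegral_dirac' _ hh, smul_eq_mul]

theorem atomMeasure_apply {s : Set ℝ} (hs : MeasurableSet s) :
    atomMeasure r p β c f s = ∑' i : ℕ, ∑' n : ℕ,
      s.indicator (fun _ => atomWeight r n i) (f (c * jumpLevel p β n i)) := by
  rw [atomMeasure, Measure.sum_apply _ hs, ENNReal.tsum_prod']
  refine tsum_congr fun i => tsum_congr fun n => ?_
  rw [Measure.smul_apply, Measure.dirac_apply' _ hs, smul_eq_mul]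
  by_cases hmem : f (c * jumpLevel p β n i) ∈ s <;> simp [hmem]

theorem atomMeasure_Iic_of_nonpos (hf : IsIncreasingHomeo f) (hc : 0 < c) {y : ℝ} (hy : y ≤ 0) :
    atomMeasure r p β c f (Set.Iic y) = 0 := by
  rw [atomMeasure_apply measurableSet_Iic]
  refine ENNReal.tsum_eq_zero.2 fun i => ENNReal.tsum_eq_zero.2 fun n => ?_
  by_cases hin : 1 ≤ i ∧ i ≤ n
  · have hpos := hf.pos (mul_pos hc (jumpLevel_pos (p := p) (β := β) (hin.1.trans hin.2) hin.1))
    exact Set.indicator_of_notMem (by simpa using hy.trans_lt hpos) _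
  · simp [atomWeight, hin]

theorem atomMeasure_Iic_le_atomCount (hf : IsIncreasingHomeo f) (hc : 0 < c) {T : ℝ}
    (hT : 0 ≤ T) : atomMeasure r p β c f (Set.Iic (f T)) ≤ atomCount r p β (T / c) := by
  rw [atomMeasure_apply measurableSet_Iic]
  refine ENNReal.tsum_le_tsum fun i => ENNReal.tsum_le_tsum fun n => ?_
  rw [Set.indicator_apply]
  have hlevel : 0 ≤ c * jumpLevel p β n i := mul_nonneg hc.le (jumpLevel_nonneg p β n i)
  simp only [Set.mem_Iic, hf.strictMonoOn.le_iff_le hlevel hT, le_div_iff₀' hc, le_refl]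

theorem atomCount_le_atomMeasure_Iio (hf : IsIncreasingHomeo f) (hc : 0 < c) {T : ℝ}
    (hT : 0 < T) : atomCount r p β (T / (2 * c)) ≤ atomMeasure r p β c f (Set.Iio (f T)) := by
  rw [atomMeasure_apply measurableSet_Iio]
  refine ENNReal.tsum_le_tsum fun i => ENNReal.tsum_le_tsum fun n => ?_
  have hlevel : 0 ≤ c * jumpLevel p β n i := mul_nonneg hc.le (jumpLevel_nonneg p β n i)
  split_ifs with hle
  · rw [le_div_iff₀ (by positivity)] at hle
    rw [Set.indicator_of_mem]
    exact hf.strictMonoOn hlevel hT.le (by linarith)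
  · exact zero_le

theorem tailSeries_lt_top_of_lintegral (hr : 1 < r) (hp : 0 < p) (hβ : 0 < β + p)
    (hf : IsIncreasingHomeo f) (hG : GrowthComparable r p β f) (hc : 0 < c) {h : ℝ → ℝ}
    (hh : Antitone h) (h0 : ∀ x, 0 ≤ h x) (h1 : ∀ x, h x ≤ 1)
    (hint : ∫⁻ x in Set.Ioi (0 : ℝ), ENNReal.ofReal (h x) < ⊤) :
    tailSeries r p β c (fun t => ENNReal.ofReal (h (f t))) < ⊤ := by
  obtain ⟨C, hC, hcount⟩ := hG.exists_atomCount_le hr hp hβ hc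
  rw [← lintegral_atomMeasure (h := fun x => ENNReal.ofReal (h x)) hh.measurable.ennreal_ofReal]
  refine (lintegral_le_of_measure_Iic_le (C := C) (fun y => ?_) hh h0 h1).trans_lt
    (ENNReal.mul_lt_top ENNReal.ofReal_lt_top (ENNReal.add_lt_top.2 ⟨hint, ENNReal.one_lt_top⟩))
  rcases le_or_gt y 0 with hy | hy
  · rw [atomMeasure_Iic_of_nonpos hf hc hy]
    exact zero_le
  obtain ⟨T, hT, rfl⟩ := hf.exists_eq_of_pos hy
  calc atomMeasure r p β c f (Set.Iic (f T)) ≤ ENNReal.ofReal (C * f T) :=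
        (atomMeasure_Iic_le_atomCount hf hc hT.le).trans (hcount T hT)
    _ = ENNReal.ofReal C * (volume.restrict (Set.Ioi 0)) (Set.Iio (f T)) := by
        rw [Measure.restrict_apply measurableSet_Iio, Set.inter_comm, Set.Ioi_inter_Iio,
          Real.volume_Ioo, sub_zero, ENNReal.ofReal_mul hC]
    _ ≤ _ := by
        gcongr
        exact le_self_add

theorem lintegral_lt_top_of_tailSeries (hp : 0 < p) (hβ : 0 < β + p)
    (hf : IsIncreasingHomeo f) (hG : GrowthComparable r p β f) (hc : 0 < c) {h : ℝ → ℝ}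
    (hh : Antitone h) (h0 : ∀ x, 0 ≤ h x) (h1 : ∀ x, h x ≤ 1)
    (hseries : tailSeries r p β c (fun t => ENNReal.ofReal (h (f t))) < ⊤) :
    ∫⁻ x in Set.Ioi (0 : ℝ), ENNReal.ofReal (h x) < ⊤ := by
  obtain ⟨C, -, hcount⟩ := hG.exists_le_atomCount hf.strictMonoOn.monotoneOn hp hβ
    (c := 2 * c) (by positivity)
  rw [← lintegral_atomMeasure (h := fun x => ENNReal.ofReal (h x)) hh.measurable.ennreal_ofReal]
    at hseries
  refine (lintegral_le_of_measure_Iic_le (C := C) (fun y => ?_) hh h0 h1).trans_lt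
    (ENNReal.mul_lt_top ENNReal.ofReal_lt_top (ENNReal.add_lt_top.2 ⟨hseries, ENNReal.one_lt_top⟩))
  rw [Measure.restrict_apply measurableSet_Iic, Set.inter_comm, Set.Ioi_inter_Iic,
    Real.volume_Ioc, sub_zero]
  rcases le_or_gt y 0 with hy | hy
  · rw [ENNReal.ofReal_of_nonpos hy]
    exact zero_le
  obtain ⟨T, hT, rfl⟩ := hf.exists_eq_of_pos hy
  refine (hcount T hT).trans ?_
  gcongr
  exact atomCount_le_atomMeasure_Iio hf hc hT

end AtomMeasure

namespace SublinearExpectationSpace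

variable {Ω : Type*} [MeasurableSpace Ω] {S : SublinearExpectationSpace Ω}

theorem choquet_lt_top_iff {Y : Ω → ℝ} (hY : ∀ ω, 0 ≤ Y ω) :
    S.choquet Y < ⊤ ↔ ∫⁻ x in Set.Ioi (0 : ℝ), S.capacity {ω | x < Y ω} < ⊤ := by
  have hneg : ∫⁻ x in Set.Iio (0 : ℝ), (1 - S.capacity {ω | x < Y ω}) = 0 := by
    rw [setLIntegral_congr_fun (g := fun _ => 0) measurableSet_Iio fun x hx => ?_, lintegral_zero]
    have huniv : {ω | x < Y ω} = Set.univ := Set.eq_univ_of_forall fun ω => lt_of_lt_of_le hx (hY ω)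
    simp only [huniv, capacity_univ, tsub_self]
  rw [choquet, hneg, EReal.coe_ennreal_zero, sub_zero, lt_top_iff_ne_top, lt_top_iff_ne_top,
    Ne, EReal.coe_ennreal_eq_top_iff]

section ChoquetSeries

variable {r p β c : ℝ} {f : ℝ → ℝ}

theorem antitone_capacityReal (S : SublinearExpectationSpace Ω) (Y : Ω → ℝ) :
    Antitone fun x => S.capacityReal {ω | x < Y ω} := fun _ _ hxy =>
  ENNReal.toReal_mono (capacity_ne_top _) (capacity_mono fun _ hω => lt_of_le_of_lt hxy hω)

theorem choquet_comp_abs_lt_top_iff (hr : 1 < r) (hp : 0 < p) (hβ : 0 < β + p)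
    (hf : IsIncreasingHomeo f) (hG : GrowthComparable r p β f) (hc : 0 < c) (X : Ω → ℝ) :
    S.choquet (fun ω => f |X ω|) < ⊤ ↔
      tailSeries r p β c (fun t => S.capacity {ω | t < |X ω|}) < ⊤ := by
  have hanti := S.antitone_capacityReal fun ω => f |X ω|
  have hseries : tailSeries r p β c (fun t => S.capacity {ω | t < |X ω|})
      = tailSeries r p β c (fun t => ENNReal.ofReal (S.capacityReal {ω | f t < f |X ω|})) := by
    refine tsum_congr fun n => tsum_congr fun i => ?_
    simp only [ofReal_capacityReal,
      hf.setOf_comp_lt_comp_abs X (mul_nonneg hc.le (jumpLevel_nonneg p β n i))]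
  rw [choquet_lt_top_iff fun ω => hf.nonneg (abs_nonneg _), hseries]
  simp only [← ofReal_capacityReal]
  exact ⟨tailSeries_lt_top_of_lintegral hr hp hβ hf hG hc hanti
      (fun _ => capacityReal_nonneg _) fun _ => capacityReal_le_one _,
    lintegral_lt_top_of_tailSeries hp hβ hf hG hc hanti
      (fun _ => capacityReal_nonneg _) fun _ => capacityReal_le_one _⟩

theorem exists_hasTailDecay_of_choquet_lt_top {q : ℝ} (hf : IsIncreasingHomeo f) (hc : 0 < c)
    (hq : 0 ≤ q) (hqf : ∀ t, 1 ≤ t → c * t ^ q ≤ f t) {X : Ω → ℝ}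
    (hX : S.choquet (fun ω => f |X ω|) < ⊤) : ∃ K, S.HasTailDecay X K q := by
  rw [choquet_lt_top_iff fun ω => hf.nonneg (abs_nonneg _)] at hX
  set I := ∫⁻ x in Set.Ioi (0 : ℝ), S.capacity {ω | x < f |X ω|}
  refine ⟨max (I.toReal / c) 1, fun t ht => ?_⟩
  rcases le_total t 1 with ht1 | ht1
  · calc S.capacityReal {ω | t < |X ω|} ≤ 1 * 1 := by simpa using capacityReal_le_one _
      _ ≤ max (I.toReal / c) 1 * t ^ (-q) := by
        gcongr
        · exact le_max_right _ _
        · exact Real.one_le_rpow_of_pos_of_le_one_of_nonpos ht ht1 (by linarith)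
  · have hmarkov : f t * S.capacityReal {ω | t < |X ω|} ≤ I.toReal := by
      have hle := ofReal_mul_le_setLIntegral_Ioi (h := fun x => S.capacity {ω | x < f |X ω|})
        (fun _ _ hxy => capacity_mono fun _ hω => lt_of_le_of_lt hxy hω) (f t)
      rw [hf.setOf_comp_lt_comp_abs X ht.le, ← ofReal_capacityReal,
        ← ENNReal.ofReal_mul (hf.nonneg ht.le)] at hle
      exact (ENNReal.ofReal_le_iff_le_toReal hX.ne).1 hle
    calc S.capacityReal {ω | t < |X ω|} ≤ I.toReal / c * t ^ (-q) := by
          rw [Real.rpow_neg ht.le, ← div_eq_mul_inv, div_div, le_div_iff₀' (by positivity)]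
          exact (mul_le_mul_of_nonneg_right (hqf t ht1) (capacityReal_nonneg _)).trans hmarkov
      _ ≤ max (I.toReal / c) 1 * t ^ (-q) := by
        gcongr
        exact le_max_left _ _

end ChoquetSeries

end SublinearExpectationSpace

/-! ### Complete convergence -/

section Weights

variable {p β q η : ℝ} {n i : ℕ}

theorem weight_eq_inv_jumpLevel (hn : 1 ≤ n) (hi : 1 ≤ i) :
    ((i : ℝ) / (n : ℝ)) ^ β * (1 / (n : ℝ)) ^ p = (jumpLevel p β n i)⁻¹ := by
  have hn0 : (0 : ℝ) < n := by exact_mod_cast hn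
  have hi0 : (0 : ℝ) < i := by exact_mod_cast hi
  rw [jumpLevel, Real.div_rpow hi0.le hn0.le, Real.div_rpow zero_le_one hn0.le, Real.one_rpow,
    Real.rpow_add hn0, Real.rpow_neg hi0.le, mul_inv, inv_inv, mul_inv]
  ring

theorem inv_jumpLevel_rpow_eq (hn : 1 ≤ n) (hi : 1 ≤ i) :
    ((jumpLevel p β n i)⁻¹) ^ q
      = (i : ℝ)⁻¹ * ((i : ℝ) ^ (β * q + 1) * (n : ℝ) ^ (-((p + β) * q))) := by
  have hn0 : (0 : ℝ) < n := by exact_mod_cast hn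
  have hi0 : (0 : ℝ) < i := by exact_mod_cast hi
  rw [jumpLevel, Real.rpow_add_one hi0.ne', mul_inv, ← Real.rpow_neg hn0.le,
    ← Real.rpow_neg hi0.le, neg_neg, Real.mul_rpow (by positivity) (by positivity),
    ← Real.rpow_mul hn0.le, ← Real.rpow_mul hi0.le, neg_mul]
  field_simp

theorem inv_jumpLevel_rpow_le (hη : η ≤ (p + β) * q) (hη' : η ≤ p * q - 1) (hi : 1 ≤ i)
    (hin : i ≤ n) : ((jumpLevel p β n i)⁻¹) ^ q ≤ (i : ℝ)⁻¹ * (n : ℝ) ^ (-η) := by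
  have hi1 : (1 : ℝ) ≤ i := by exact_mod_cast hi
  have hin' : (i : ℝ) ≤ n := by exact_mod_cast hin
  have hn1 : (1 : ℝ) ≤ n := hi1.trans hin'
  have hn0 : (0 : ℝ) < n := zero_lt_one.trans_le hn1
  rw [inv_jumpLevel_rpow_eq (hi.trans hin) hi]
  refine mul_le_mul_of_nonneg_left ?_ (by positivity)
  rcases le_total 0 (β * q + 1) with h | h
  · calc (i : ℝ) ^ (β * q + 1) * (n : ℝ) ^ (-((p + β) * q))
        ≤ (n : ℝ) ^ (β * q + 1) * (n : ℝ) ^ (-((p + β) * q)) := by gcongr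
      _ = (n : ℝ) ^ (-(p * q - 1)) := by rw [← Real.rpow_add hn0]; ring_nf
      _ ≤ (n : ℝ) ^ (-η) := Real.rpow_le_rpow_of_exponent_le hn1 (neg_le_neg hη')
  · calc (i : ℝ) ^ (β * q + 1) * (n : ℝ) ^ (-((p + β) * q))
        ≤ 1 * (n : ℝ) ^ (-((p + β) * q)) := by
          gcongr
          exact Real.rpow_le_one_of_one_le_of_nonpos hi1 h
      _ ≤ (n : ℝ) ^ (-η) := by
          rw [one_mul]
          exact Real.rpow_le_rpow_of_exponent_le hn1 (neg_le_neg hη)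

theorem sum_inv_le_mul_rpow (hη : 0 < η) (hn : 1 ≤ n) :
    ∑ i ∈ Finset.Icc 1 n, (i : ℝ)⁻¹ ≤ (1 + 1 / η) * (n : ℝ) ^ η := by
  have hn1 : (1 : ℝ) ≤ n := by exact_mod_cast hn
  calc ∑ i ∈ Finset.Icc 1 n, (i : ℝ)⁻¹ ≤ 1 + Real.log n := by
        simpa [harmonic_eq_sum_Icc] using harmonic_le_one_add_log n
    _ ≤ (n : ℝ) ^ η + (n : ℝ) ^ η / η :=
        add_le_add (Real.one_le_rpow hn1 hη.le) (Real.log_le_rpow_div n.cast_nonneg hη)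
    _ = (1 + 1 / η) * (n : ℝ) ^ η := by ring

theorem exists_sum_inv_jumpLevel_rpow_le (hβ : 0 < β + p) (hq : 0 < q) (hpq : 1 < p * q) :
    ∃ η : ℝ, 0 < η ∧ ∃ C : ℝ, 0 ≤ C ∧ ∀ n : ℕ, 1 ≤ n →
      ∑ i ∈ Finset.Icc 1 n, ((jumpLevel p β n i)⁻¹) ^ q ≤ C * (n : ℝ) ^ (-η) := by
  have hpb : 0 < p + β := by linarith
  obtain ⟨η, hη, hη'⟩ : ∃ η : ℝ, 0 < η ∧ 2 * η ≤ min ((p + β) * q) (p * q - 1) :=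
    ⟨_, half_pos (lt_min (by positivity) (by linarith)), (mul_div_cancel₀ _ two_ne_zero).le⟩
  obtain ⟨hη₁, hη₂⟩ := le_min_iff.1 hη'
  refine ⟨η, hη, 1 + 1 / η, by positivity, fun n hn => ?_⟩
  have hn0 : (0 : ℝ) < n := by exact_mod_cast hn
  calc ∑ i ∈ Finset.Icc 1 n, ((jumpLevel p β n i)⁻¹) ^ q
      ≤ ∑ i ∈ Finset.Icc 1 n, (i : ℝ)⁻¹ * (n : ℝ) ^ (-(2 * η)) :=
        Finset.sum_le_sum fun i hi =>
          inv_jumpLevel_rpow_le hη₁ hη₂ (Finset.mem_Icc.1 hi).1 (Finset.mem_Icc.1 hi).2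
    _ ≤ ((1 + 1 / η) * (n : ℝ) ^ η) * (n : ℝ) ^ (-(2 * η)) := by
        rw [← Finset.sum_mul]
        gcongr
        exact sum_inv_le_mul_rpow hη hn
    _ = (1 + 1 / η) * (n : ℝ) ^ (-η) := by
        rw [mul_assoc, ← Real.rpow_add hn0]
        ring_nf

end Weights

theorem log_mul_rpow_neg_le {x η : ℝ} (hx : 0 < x) (hη : 0 < η) :
    Real.log x * x ^ (-η) ≤ 1 / η := by
  rw [Real.rpow_neg hx.le, ← div_eq_mul_inv, div_le_iff₀ (by positivity), one_div_mul_eq_div]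
  exact Real.log_le_rpow_div hx.le hη

/-- With `l = (r / ε) * log x` and truncation level `η * ε / (2 * r)`, the factor `exp (-l * ε)`
is `x ^ (-r)` and `exp (l * δ)` is only `x ^ (η / 2)`. -/
theorem exists_chernoff_le_rpow {r ε η B : ℝ} (hr : 0 < r) (hε : 0 < ε) (hη : 0 < η)
    (hB : 0 ≤ B) :
    ∃ K : ℝ, 0 ≤ K ∧ ∀ x s : ℝ, 1 ≤ x → s ≤ B * x ^ (-η) →
      Real.exp (-(r / ε * Real.log x * ε) + (r / ε * Real.log x * s
        + (r / ε * Real.log x) ^ 2 * Real.exp (r / ε * Real.log x * (η * ε / (2 * r))) * s))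
      ≤ K * x ^ (-r) := by
  refine ⟨Real.exp (r / ε * B * (1 / η) + (r / ε) ^ 2 * B * (1 / (η / 4)) ^ 2),
    (Real.exp_pos _).le, fun x s hx hs => ?_⟩
  have hx0 : 0 < x := by linarith
  have hlog : 0 ≤ Real.log x := Real.log_nonneg hx
  have hexp : Real.exp (r / ε * Real.log x * (η * ε / (2 * r))) = x ^ (η / 2) := by
    rw [Real.rpow_def_of_pos hx0]
    congr 1
    field_simp
  have hmean : r / ε * Real.log x * s ≤ r / ε * B * (1 / η) :=
    calc r / ε * Real.log x * s ≤ r / ε * Real.log x * (B * x ^ (-η)) := by gcongr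
      _ = r / ε * B * (Real.log x * x ^ (-η)) := by ring
      _ ≤ r / ε * B * (1 / η) := by gcongr; exact log_mul_rpow_neg_le hx0 hη
  have hsplit : x ^ (η / 2) * x ^ (-η) = (x ^ (-(η / 4))) ^ 2 := by
    rw [← Real.rpow_add hx0, ← Real.rpow_mul_natCast hx0.le]
    ring_nf
  have hvariance : (r / ε * Real.log x) ^ 2 * x ^ (η / 2) * s
      ≤ (r / ε) ^ 2 * B * (1 / (η / 4)) ^ 2 :=
    calc (r / ε * Real.log x) ^ 2 * x ^ (η / 2) * s
        ≤ (r / ε * Real.log x) ^ 2 * x ^ (η / 2) * (B * x ^ (-η)) := by gcongr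
      _ = (r / ε) ^ 2 * B * (Real.log x) ^ 2 * (x ^ (η / 2) * x ^ (-η)) := by ring
      _ = (r / ε) ^ 2 * B * (Real.log x * x ^ (-(η / 4))) ^ 2 := by rw [hsplit]; ring
      _ ≤ (r / ε) ^ 2 * B * (1 / (η / 4)) ^ 2 := by
          gcongr
          exact log_mul_rpow_neg_le hx0 (by positivity)
  rw [hexp, Real.rpow_def_of_pos hx0 (-r), ← Real.exp_add, Real.exp_le_exp,
    show -(r / ε * Real.log x * ε) = Real.log x * -r by field_simp]
  linarith

theorem prod_one_sub_mul_one_add_sum_le_one {ι : Type*} (s : Finset ι) {g : ι → ℝ}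
    (h0 : ∀ i ∈ s, 0 ≤ g i) (h1 : ∀ i ∈ s, g i ≤ 1) :
    (∏ i ∈ s, (1 - g i)) * (1 + ∑ i ∈ s, g i) ≤ 1 := by
  have hsum : 0 ≤ ∑ i ∈ s, g i := Finset.sum_nonneg h0
  calc (∏ i ∈ s, (1 - g i)) * (1 + ∑ i ∈ s, g i)
      ≤ (∏ i ∈ s, Real.exp (-g i)) * Real.exp (∑ i ∈ s, g i) := by
        gcongr with i
        · exact fun i hi => sub_nonneg.2 (h1 i hi)
        · exact Real.one_sub_le_exp_neg (g i)
        · linarith [Real.add_one_le_exp (∑ i ∈ s, g i)]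
    _ = 1 := by rw [← Real.exp_sum, ← Real.exp_add, Finset.sum_neg_distrib, neg_add_cancel,
        Real.exp_zero]

theorem sum_le_two_mul_one_sub_prod {ι : Type*} (s : Finset ι) {g : ι → ℝ}
    (h0 : ∀ i ∈ s, 0 ≤ g i) (h1 : ∀ i ∈ s, g i ≤ 1) (h : 1 - ∏ i ∈ s, (1 - g i) ≤ 1 / 2) :
    ∑ i ∈ s, g i ≤ 2 * (1 - ∏ i ∈ s, (1 - g i)) := by
  have hmul := prod_one_sub_mul_one_add_sum_le_one s h0 h1
  have hhalf : 1 / 2 * ∑ i ∈ s, g i ≤ (∏ i ∈ s, (1 - g i)) * ∑ i ∈ s, g i :=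
    mul_le_mul_of_nonneg_right (by linarith) (Finset.sum_nonneg h0)
  linarith

theorem tsum_pnat_lt_top_iff {f : ℕ → ℝ≥0∞} (h0 : f 0 < ⊤) :
    ∑' n : ℕ+, f n < ⊤ ↔ ∑' n : ℕ, f n < ⊤ := by
  rw [tsum_pnat_eq_tsum_succ (f := f), tsum_eq_zero_add' (f := f) ENNReal.summable,
    ENNReal.add_lt_top]
  exact (and_iff_right h0).symm

theorem lt_maxWeightedSum_iff {Ω : Type*} {a : ℕ → ℕ → ℝ} {X : ℕ → Ω → ℝ} {n : ℕ+} {ω : Ω}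
    {ε : ℝ} : ε < maxWeightedSum a X n ω
      ↔ ∃ j ∈ Finset.Icc 1 (n : ℕ), ε < |∑ i ∈ Finset.Icc 1 j, a n i * X i ω| :=
  Finset.lt_sup'_iff _

namespace SublinearExpectationSpace

variable {Ω : Type*}

/-- The event `max_{1 ≤ j ≤ n} |∑_{i=1}^j b_i X_i| > ε`. -/
def maxSumEvent (b : ℕ → ℝ) (Xs : ℕ → Ω → ℝ) (ε : ℝ) (n : ℕ) : Set Ω :=
  {ω | ∃ j ∈ Finset.Icc 1 n, ε < |∑ i ∈ Finset.Icc 1 j, b i * Xs i ω|}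

theorem maxSumEvent_subset (b : ℕ → ℝ) (Xs : ℕ → Ω → ℝ) {δ : ℝ} (hδ : 0 ≤ δ) (ε : ℝ) (n : ℕ) :
    maxSumEvent b Xs ε n ⊆ (⋃ i ∈ Finset.Icc 1 n, {ω | δ < |b i * Xs i ω|}) ∪
      ({ω | ∃ j ≤ n, ε < ∑ i ∈ Finset.Icc 1 j, clip δ (b i * Xs i ω)} ∪
        {ω | ∃ j ≤ n, ε < ∑ i ∈ Finset.Icc 1 j, clip δ (-b i * Xs i ω)}) := by
  rintro ω ⟨j, hj, hlt⟩
  have hjn := (Finset.mem_Icc.1 hj).2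
  by_cases hbig : ∃ i ∈ Finset.Icc 1 n, δ < |b i * Xs i ω|
  · exact Or.inl (Set.mem_iUnion₂.2 (by simpa using hbig))
  · push Not at hbig
    have hclip : ∑ i ∈ Finset.Icc 1 j, clip δ (b i * Xs i ω)
        = ∑ i ∈ Finset.Icc 1 j, b i * Xs i ω :=
      Finset.sum_congr rfl fun i hi => clip_of_abs_le (hbig i (Finset.Icc_subset_Icc_right hjn hi))
    right
    rcases lt_abs.1 hlt with h | h
    · exact Or.inl ⟨j, hjn, by rwa [hclip]⟩
    · exact Or.inr ⟨j, hjn, by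
        simpa only [neg_mul, clip_neg hδ, Finset.sum_neg_distrib, hclip] using h⟩

variable [MeasurableSpace Ω] {S : SublinearExpectationSpace Ω}

section IdentDistributed

variable {X Y : Ω → ℝ}

theorem IdentDistributed.expect_eq
    (h : IdentDistributed S S (fun _ : Fin 1 => X) (fun _ : Fin 1 => Y)) {φ : ℝ → ℝ}
    (hφ : Measurable φ) (hX : S.IsBdd fun ω => φ (X ω)) (hY : S.IsBdd fun ω => φ (Y ω)) :
    S.expect (fun ω => φ (X ω)) = S.expect fun ω => φ (Y ω) :=
  congrArg EReal.toReal <| h (fun x => φ (x 0)) (hφ.comp (measurable_pi_apply 0)) hX.1 hY.1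
    (by rw [← hX.coe_expect]; exact EReal.coe_ne_top _)
    (by rw [← hX.coe_expect]; exact EReal.coe_ne_bot _)
    (by rw [← hY.coe_expect]; exact EReal.coe_ne_top _)
    (by rw [← hY.coe_expect]; exact EReal.coe_ne_bot _)

theorem IdentDistributed.capacityReal_preimage_eq
    (h : IdentDistributed S S (fun _ : Fin 1 => X) (fun _ : Fin 1 => Y)) (hX : Measurable X)
    (hY : Measurable Y) {B : Set ℝ} (hB : MeasurableSet B) :
    S.capacityReal (X ⁻¹' B) = S.capacityReal (Y ⁻¹' B) := by
  rw [capacityReal_eq_expect (hX hB), capacityReal_eq_expect (hY hB)]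
  exact h.expect_eq (measurable_const.indicator hB) (IsBdd.indicator (hX hB))
    (IsBdd.indicator (hY hB))

end IdentDistributed

theorem E_const_mul_eq_zero {X : Ω → ℝ} (hX : X ∈ S.H) (h : S.E X = 0)
    (hneg : S.E (fun ω => -X ω) = 0) (b : ℝ) : S.E (fun ω => b * X ω) = 0 := by
  rcases le_total 0 b with hb | hb
  · rw [S.pos_homogeneous X hX b hb, h, mul_zero]
  · have hX' : (fun ω => -X ω) ∈ S.H := by simpa using const_mul_mem hX (-1)
    simpa [hneg] using S.pos_homogeneous _ hX' (-b) (neg_nonneg.2 hb)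

/-- The variables `Xs 1, Xs 2, …` are independent and each is distributed as `X`. -/
structure IsIndepCopies (S : SublinearExpectationSpace Ω) (X : Ω → ℝ) (Xs : ℕ → Ω → ℝ) :
    Prop where
  mem : X ∈ S.H
  mem_copy : ∀ n, 1 ≤ n → Xs n ∈ S.H
  indep : S.IndepSeq Xs
  ident : ∀ n, 1 ≤ n → IdentDistributed S S (fun _ : Fin 1 => Xs n) (fun _ : Fin 1 => X)

namespace IsIndepCopies

variable {X : Ω → ℝ} {Xs : ℕ → Ω → ℝ} {K q δ : ℝ}

theorem capacityReal_preimage_eq (h : S.IsIndepCopies X Xs) {n : ℕ} (hn : 1 ≤ n) {B : Set ℝ}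
    (hB : MeasurableSet B) : S.capacityReal (Xs n ⁻¹' B) = S.capacityReal (X ⁻¹' B) :=
  (h.ident n hn).capacityReal_preimage_eq (S.measurable_of_mem _ (h.mem_copy n hn))
    (S.measurable_of_mem _ h.mem) hB

theorem capacity_preimage_eq (h : S.IsIndepCopies X Xs) {n : ℕ} (hn : 1 ≤ n) {B : Set ℝ}
    (hB : MeasurableSet B) : S.capacity (Xs n ⁻¹' B) = S.capacity (X ⁻¹' B) := by
  rw [← ofReal_capacityReal, h.capacityReal_preimage_eq hn hB, ofReal_capacityReal]

theorem exists_capacity_lt_sum_clip_le (h : S.IsIndepCopies X Xs) (hS : S.CountablySubadditive)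
    (hK : S.HasTailDecay X K q) (hq1 : q ≠ 1) (hq2 : q < 2)
    (hmean : 1 < q → ∀ b : ℝ, S.E (fun ω => b * X ω) = 0) (hδ : 0 < δ) :
    ∃ C : ℝ, 0 ≤ C ∧ ∀ (b : ℕ → ℝ) (n : ℕ) (l ε : ℝ), 0 < l →
      S.capacity {ω | ∃ j ≤ n, ε < ∑ i ∈ Finset.Icc 1 j, clip δ (b i * Xs i ω)}
        ≤ ENNReal.ofReal (Real.exp (-(l * ε) + (l * (C * ∑ i ∈ Finset.Icc 1 n, |b i| ^ q)
          + l ^ 2 * Real.exp (l * δ) * (C * ∑ i ∈ Finset.Icc 1 n, |b i| ^ q)))) := by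
  obtain ⟨C₁, hC₁⟩ := hS.exists_expect_clip_le hδ hq1
  obtain ⟨C₂, hC₂⟩ := hS.exists_expect_abs_clip_pow_le hδ two_ne_zero (q := q)
    (by exact_mod_cast hq2)
  have hK0 := hK.nonneg
  have hbdd : ∀ {Z : Ω → ℝ}, Z ∈ S.H → ∀ b : ℝ, S.IsBdd fun ω => clip δ (b * Z ω) :=
    fun hZ b => IsBdd.clip (const_mul_mem hZ b) hδ.le
  have hmeas : ∀ b : ℝ, Measurable fun x => clip δ (b * x) := fun b =>
    (measurable_clip δ).comp (measurable_const_mul b)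
  refine ⟨max 0 (max C₁ C₂) * K, by positivity, fun b n l ε hl => ?_⟩
  have hfirst : ∀ i, 1 ≤ i → S.expect (fun ω => clip δ (b i * Xs i ω))
      ≤ max 0 (max C₁ C₂) * K * |b i| ^ q := fun i hi => by
    rw [(h.ident i hi).expect_eq (hmeas (b i)) (hbdd (h.mem_copy i hi) _) (hbdd h.mem _), mul_assoc]
    refine (hC₁ _ (const_mul_mem h.mem _) _ (hK.const_mul _) fun hq => hmean hq _).trans ?_
    gcongr
    exact (le_max_left _ _).trans (le_max_right _ _)
  have hsecond : ∀ i, 1 ≤ i → S.expect (fun ω => clip δ (b i * Xs i ω) ^ 2)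
      ≤ max 0 (max C₁ C₂) * K * |b i| ^ q := fun i hi => by
    rw [(h.ident i hi).expect_eq ((hmeas (b i)).pow_const 2) ((hbdd (h.mem_copy i hi) _).pow 2)
      ((hbdd h.mem _).pow 2), mul_assoc]
    have hsq := hC₂ _ (const_mul_mem h.mem (b i)) _ (hK.const_mul _)
    simp only [sq_abs] at hsq
    refine hsq.trans ?_
    gcongr
    exact (le_max_right _ _).trans (le_max_right _ _)
  refine (h.indep.capacity_exists_lt_sum_le (fun i => hmeas (b i)) (fun i x => abs_clip_le hδ.le _)
    (fun i hi => hbdd (h.mem_copy i hi) _) (fun i => by positivity) (fun i => by positivity) hfirst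
    hsecond hl ε n).trans_eq ?_
  rw [Finset.sum_add_distrib]
  simp only [← Finset.mul_sum]

theorem exists_capacity_maxSumEvent_le (h : S.IsIndepCopies X Xs) (hS : S.CountablySubadditive)
    (hK : S.HasTailDecay X K q) (hq1 : q ≠ 1) (hq2 : q < 2)
    (hmean : 1 < q → ∀ b : ℝ, S.E (fun ω => b * X ω) = 0) (hδ : 0 < δ) :
    ∃ C : ℝ, 0 ≤ C ∧ ∀ (b : ℕ → ℝ) (n : ℕ) (l ε : ℝ), 0 < l →
      S.capacity (maxSumEvent b Xs ε n) ≤ ∑ i ∈ Finset.Icc 1 n, S.capacity {ω | δ < |b i * X ω|}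
        + 2 * ENNReal.ofReal (Real.exp (-(l * ε) + (l * (C * ∑ i ∈ Finset.Icc 1 n, |b i| ^ q)
          + l ^ 2 * Real.exp (l * δ) * (C * ∑ i ∈ Finset.Icc 1 n, |b i| ^ q)))) := by
  obtain ⟨C, hC0, hC⟩ := h.exists_capacity_lt_sum_clip_le hS hK hq1 hq2 hmean hδ
  refine ⟨C, hC0, fun b n l ε hl => ?_⟩
  have hneg := hC (-b) n l ε hl
  simp only [Pi.neg_apply, abs_neg] at hneg
  refine (capacity_mono (maxSumEvent_subset b Xs hδ.le ε n)).trans <|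
    (capacity_union_le _ _).trans (add_le_add ?_ ?_)
  · refine (capacity_biUnion_le _ _).trans (Finset.sum_le_sum fun i hi => le_of_eq ?_)
    exact h.capacity_preimage_eq (Finset.mem_Icc.1 hi).1 (B := {x | δ < |b i * x|})
      (measurableSet_lt measurable_const (measurable_const_mul _).abs)
  · rw [two_mul]
    exact (capacity_union_le _ _).trans (add_le_add (hC b n l ε hl) hneg)

end IsIndepCopies

end SublinearExpectationSpace

theorem tsum_lt_top_of_eventually_le {f g : ℕ → ℝ≥0∞} (hf : ∀ n, f n ≠ ⊤)
    (hfg : ∀ᶠ n in Filter.atTop, f n ≤ g n) (hg : ∑' n, g n < ⊤) : ∑' n, f n < ⊤ := by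
  obtain ⟨N, hN⟩ := Filter.eventually_atTop.1 hfg
  rw [← ENNReal.summable.sum_add_tsum_nat_add' (f := f) (k := N)]
  refine ENNReal.add_lt_top.2 ⟨ENNReal.sum_lt_top.2 fun n _ => (hf n).lt_top, ?_⟩
  calc ∑' n, f (n + N) ≤ ∑' n, g (n + N) :=
        ENNReal.tsum_le_tsum fun n => hN _ (Nat.le_add_left _ _)
    _ ≤ ∑' n, g n := ENNReal.tsum_comp_le_tsum_of_injective (add_left_injective N) g
    _ < ⊤ := hg

theorem mul_le_tsum_rpow_mul {s : ℝ} {n : ℕ} (hn : 1 ≤ n) {c : ℝ≥0∞} {v : ℕ → ℝ≥0∞}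
    (h : ∀ m, n ≤ m → m ≤ 2 * n → c ≤ v m) :
    c * ENNReal.ofReal (2 ^ (-|s|) * (n : ℝ) ^ (s + 1))
      ≤ ∑' m : ℕ, ENNReal.ofReal ((m : ℝ) ^ s) * v m := by
  have hn0 : (0 : ℝ) < n := by exact_mod_cast hn
  have hblock : ∀ m ∈ Finset.Icc n (2 * n),
      ENNReal.ofReal (2 ^ (-|s|) * (n : ℝ) ^ s) * c ≤ ENNReal.ofReal ((m : ℝ) ^ s) * v m := by
    intro m hm
    obtain ⟨hnm, hm2⟩ := Finset.mem_Icc.1 hm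
    gcongr
    · have hnm' : (n : ℝ) ≤ m := by exact_mod_cast hnm
      exact two_rpow_neg_abs_mul_rpow_le hn0 (by linarith) (by exact_mod_cast hm2)
    · exact h m hnm hm2
  calc c * ENNReal.ofReal (2 ^ (-|s|) * (n : ℝ) ^ (s + 1))
      = n * (ENNReal.ofReal (2 ^ (-|s|) * (n : ℝ) ^ s) * c) := by
        rw [Real.rpow_add_one hn0.ne', ← mul_assoc, ENNReal.ofReal_mul (by positivity),
          ENNReal.ofReal_natCast]
        ring
    _ ≤ (Finset.Icc n (2 * n)).card • (ENNReal.ofReal (2 ^ (-|s|) * (n : ℝ) ^ s) * c) := by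
        rw [nsmul_eq_mul]
        gcongr
        rw [Nat.card_Icc]
        omega
    _ ≤ ∑ m ∈ Finset.Icc n (2 * n), ENNReal.ofReal ((m : ℝ) ^ s) * v m :=
        Finset.card_nsmul_le_sum _ _ _ hblock
    _ ≤ ∑' m : ℕ, ENNReal.ofReal ((m : ℝ) ^ s) * v m := ENNReal.sum_le_tsum _

theorem tendsto_zero_of_tsum_rpow_mul_lt_top {s : ℝ} (hs : -1 < s) {u v : ℕ → ℝ≥0∞}
    (huv : ∀ᶠ n in Filter.atTop, ∀ m, n ≤ m → m ≤ 2 * n → u n ≤ v m)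
    (hv : ∑' n : ℕ, ENNReal.ofReal ((n : ℝ) ^ s) * v n < ⊤) :
    Filter.Tendsto u Filter.atTop (nhds 0) := by
  have hpow : Filter.Tendsto (fun n : ℕ => 2 ^ (-|s|) * (n : ℝ) ^ (s + 1))
      Filter.atTop Filter.atTop :=
    ((tendsto_rpow_atTop (by linarith)).comp tendsto_natCast_atTop_atTop).const_mul_atTop
      (by positivity)
  have hquot := ENNReal.Tendsto.const_div (ENNReal.tendsto_ofReal_atTop.comp hpow)
    (Or.inr hv.ne)
  rw [ENNReal.div_top] at hquot
  refine tendsto_of_tendsto_of_tendsto_of_le_of_le' tendsto_const_nhds hquot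
    (Filter.Eventually.of_forall fun _ => zero_le) ?_
  filter_upwards [huv, hpow.eventually_gt_atTop 0, Filter.eventually_ge_atTop 1] with n hn hpos hn1
  exact (ENNReal.le_div_iff_mul_le (Or.inl (ENNReal.ofReal_pos.2 hpos).ne')
    (Or.inl ENNReal.ofReal_ne_top)).2 (mul_le_tsum_rpow_mul hn1 hn)

theorem tailSeries_eq_tsum (r p β c : ℝ) (g : ℝ → ℝ≥0∞) :
    tailSeries r p β c g = ∑' n : ℕ, ENNReal.ofReal ((n : ℝ) ^ (r - 2))
      * ∑ i ∈ Finset.Icc 1 n, g (c * jumpLevel p β n i) := by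
  refine tsum_congr fun n => ?_
  rw [tsum_eq_sum (s := Finset.Icc 1 n) fun i hi => ?_, Finset.mul_sum]
  · exact Finset.sum_congr rfl fun i hi => by rw [atomWeight, if_pos (Finset.mem_Icc.1 hi)]
  · rw [atomWeight, if_neg (by rwa [Finset.mem_Icc] at hi), zero_mul]

theorem exists_lt_abs_sum_Icc {x : ℕ → ℝ} {ε : ℝ} {n i : ℕ} (hε : 0 ≤ ε)
    (hi : i ∈ Finset.Icc 1 n) (h : 2 * ε < |x i|) :
    ∃ j ∈ Finset.Icc 1 n, ε < |∑ k ∈ Finset.Icc 1 j, x k| := by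
  by_contra! hle
  have hle' : ∀ j ≤ n, |∑ k ∈ Finset.Icc 1 j, x k| ≤ ε := fun j hj => by
    rcases Nat.eq_zero_or_pos j with rfl | hj0
    · simpa using hε
    · exact hle j (Finset.mem_Icc.2 ⟨hj0, hj⟩)
  obtain ⟨hi1, hin⟩ := Finset.mem_Icc.1 hi
  obtain ⟨j, rfl⟩ := Nat.exists_eq_add_of_le' hi1
  have hx : x (j + 1) = ∑ k ∈ Finset.Icc 1 (j + 1), x k - ∑ k ∈ Finset.Icc 1 j, x k := by
    rw [Finset.sum_Icc_succ_top hi1, add_sub_cancel_left]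
  have := abs_sub (∑ k ∈ Finset.Icc 1 (j + 1), x k) (∑ k ∈ Finset.Icc 1 j, x k)
  rw [← hx] at this
  linarith [hle' (j + 1) hin, hle' j (Nat.le_of_succ_le hin)]

theorem ArrayApprox.exists_abs_bounds {p β : ℝ} {a : ℕ → ℕ → ℝ}
    (ha : ArrayApprox a (fun n i => ((i : ℝ) / (n : ℝ)) ^ β * (1 / (n : ℝ)) ^ p)) :
    ∃ C : ℝ, 0 < C ∧ ∀ᶠ n in Filter.atTop, ∀ i ∈ Finset.Icc 1 n,
      |a n i| ≤ C * (jumpLevel p β n i)⁻¹ ∧ (jumpLevel p β n i)⁻¹ ≤ C * |a n i| := by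
  obtain ⟨⟨C₁, hC₁, N₁, hupper⟩, C₂, hC₂, N₂, hlower⟩ := ha
  refine ⟨max C₁ C₂, hC₁.trans_le (le_max_left _ _), ?_⟩
  filter_upwards [Filter.eventually_ge_atTop N₁, Filter.eventually_ge_atTop N₂] with n hn₁ hn₂ i hi
  obtain ⟨hi1, hin⟩ := Finset.mem_Icc.1 hi
  have hJ : 0 < (jumpLevel p β n i)⁻¹ := inv_pos.2 (jumpLevel_pos (hi1.trans hin) hi1)
  have hup := hupper n hn₁ i hi1 hin
  have hlow := hlower n hn₂ i hi1 hin
  simp only [weight_eq_inv_jumpLevel (hi1.trans hin) hi1] at hup hlow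
  have ha0 : 0 < a n i := pos_of_mul_pos_right (hJ.trans_le hlow) hC₂.le
  rw [abs_of_pos ha0]
  exact ⟨hup.trans (by gcongr; exact le_max_left _ _),
    hlow.trans (by gcongr; exact le_max_right _ _)⟩

namespace SublinearExpectationSpace

variable {Ω : Type*} {p β C : ℝ} {a : ℕ → ℕ → ℝ} {Xs : ℕ → Ω → ℝ}

/-- The event that one of the first `n` variables exceeds `c` times its jump level. -/
def jumpEvent (p β c : ℝ) (Xs : ℕ → Ω → ℝ) (n : ℕ) : Set Ω :=
  {ω | ∃ i ∈ Finset.Icc 1 n, c * jumpLevel p β n i < |Xs i ω|}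

theorem jumpEvent_subset_maxSumEvent {c : ℝ} {b : ℕ → ℝ} {n : ℕ} (hc : 0 ≤ c) (hC : 0 < C)
    (hb : ∀ i ∈ Finset.Icc 1 n, (jumpLevel p β n i)⁻¹ ≤ C * |b i|) :
    jumpEvent p β c Xs n ⊆ maxSumEvent b Xs (c / (2 * C)) n := by
  rintro ω ⟨i, hi, hlt⟩
  refine exists_lt_abs_sum_Icc (x := fun i => b i * Xs i ω) (by positivity) hi ?_
  obtain ⟨hi1, hin⟩ := Finset.mem_Icc.1 hi
  have hJ : 0 < jumpLevel p β n i := jumpLevel_pos (hi1.trans hin) hi1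
  calc 2 * (c / (2 * C)) = c / C := by field_simp
    _ < |b i| * |Xs i ω| := by
        rw [div_lt_iff₀ hC]
        calc c < (jumpLevel p β n i)⁻¹ * |Xs i ω| := by rwa [lt_inv_mul_iff₀ hJ, mul_comm]
          _ ≤ C * |b i| * |Xs i ω| := by gcongr; exact hb i hi
          _ = |b i| * |Xs i ω| * C := by ring
    _ = |b i * Xs i ω| := (abs_mul _ _).symm

theorem jumpEvent_subset_of_le {c : ℝ} (hβ : 0 < β + p) (hc : 0 ≤ c) {n m : ℕ} (hnm : n ≤ m)
    (hm : m ≤ 2 * n) :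
    jumpEvent p β c Xs n ⊆ jumpEvent p β (c * 2 ^ (-(p + β))) Xs m := by
  rintro ω ⟨i, hi, hlt⟩
  refine ⟨i, Finset.Icc_subset_Icc_right hnm hi, lt_of_le_of_lt ?_ hlt⟩
  have hpb : 0 < p + β := by linarith
  have hpow : (m : ℝ) ^ (p + β) ≤ 2 ^ (p + β) * (n : ℝ) ^ (p + β) := by
    rw [← Real.mul_rpow two_pos.le n.cast_nonneg]
    gcongr
    exact_mod_cast hm
  calc c * 2 ^ (-(p + β)) * jumpLevel p β m i
      ≤ c * 2 ^ (-(p + β)) * (2 ^ (p + β) * (n : ℝ) ^ (p + β) * (i : ℝ) ^ (-β)) := by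
        unfold jumpLevel
        gcongr
    _ = c * jumpLevel p β n i := by
        rw [jumpLevel, Real.rpow_neg two_pos.le]
        field_simp

variable [MeasurableSpace Ω] {S : SublinearExpectationSpace Ω}

theorem tendsto_capacity_jumpEvent {r c : ℝ} (hr : 1 < r) (hβ : 0 < β + p) (hc : 0 < c)
    (hC : 0 < C) (ha : ∀ᶠ n in Filter.atTop, ∀ i ∈ Finset.Icc 1 n,
      (jumpLevel p β n i)⁻¹ ≤ C * |a n i|)
    (h : ∀ ε : ℝ, 0 < ε →
      ∑' n : ℕ, ENNReal.ofReal ((n : ℝ) ^ (r - 2)) * S.capacity (maxSumEvent (a n) Xs ε n) < ⊤) :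
    Filter.Tendsto (fun n => S.capacity (jumpEvent p β c Xs n)) Filter.atTop (nhds 0) := by
  refine tendsto_zero_of_tsum_rpow_mul_lt_top (by linarith) ?_
    (h (c * 2 ^ (-(p + β)) / (2 * C)) (by positivity))
  filter_upwards [Filter.eventually_forall_ge_atTop.2 ha] with n hn m hnm hm
  exact capacity_mono <| (jumpEvent_subset_of_le hβ hc.le hnm hm).trans <|
    jumpEvent_subset_maxSumEvent (by positivity) hC (hn m hnm)

end SublinearExpectationSpace

theorem sum_abs_rpow_le {ι : Type*} {s : Finset ι} {b u : ι → ℝ} {C q : ℝ} (hC : 0 ≤ C)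
    (hq : 0 ≤ q) (hu : ∀ i ∈ s, 0 ≤ u i) (hb : ∀ i ∈ s, |b i| ≤ C * u i) :
    ∑ i ∈ s, |b i| ^ q ≤ C ^ q * ∑ i ∈ s, u i ^ q := by
  rw [Finset.mul_sum]
  gcongr with i hi
  rw [← Real.mul_rpow hC (hu i hi)]
  gcongr
  exact hb i hi

namespace SublinearExpectationSpace

variable {Ω : Type*} [MeasurableSpace Ω] {S : SublinearExpectationSpace Ω}

namespace IsIndepCopies

variable {X : Ω → ℝ} {Xs : ℕ → Ω → ℝ} {r p β C c K q ε : ℝ} {a : ℕ → ℕ → ℝ} {n : ℕ}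

theorem sum_tail_le_two_mul_capacity_jumpEvent (h : S.IsIndepCopies X Xs)
    (hhalf : S.capacity (jumpEvent p β c Xs n) ≤ ENNReal.ofReal (1 / 2)) :
    ∑ i ∈ Finset.Icc 1 n, S.capacity {ω | c * jumpLevel p β n i < |X ω|}
      ≤ 2 * S.capacity (jumpEvent p β c Xs n) := by
  have hB : ∀ i, MeasurableSet {x : ℝ | c * jumpLevel p β n i < |x|} := fun i =>
    measurableSet_lt measurable_const measurable_id.abs
  set g : ℕ → ℝ := fun i => S.capacityReal {ω | c * jumpLevel p β n i < |X ω|}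
  have hprod : S.capacity (jumpEvent p β c Xs n)
      = ENNReal.ofReal (1 - ∏ i ∈ Finset.Icc 1 n, (1 - g i)) :=
    (h.indep.capacity_exists_mem_eq (fun i hi => S.measurable_of_mem _ (h.mem_copy i hi)) hB
      n).trans <| congrArg (fun x => ENNReal.ofReal (1 - x)) <| Finset.prod_congr rfl fun i hi =>
        congrArg (1 - ·) (h.capacityReal_preimage_eq (Finset.mem_Icc.1 hi).1 (hB i))
  rw [hprod, ENNReal.ofReal_le_ofReal_iff (by norm_num)] at hhalf
  calc ∑ i ∈ Finset.Icc 1 n, S.capacity {ω | c * jumpLevel p β n i < |X ω|}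
      = ENNReal.ofReal (∑ i ∈ Finset.Icc 1 n, g i) := by
        rw [ENNReal.ofReal_sum_of_nonneg fun _ _ => capacityReal_nonneg _]
        exact Finset.sum_congr rfl fun _ _ => (ofReal_capacityReal _).symm
    _ ≤ ENNReal.ofReal (2 * (1 - ∏ i ∈ Finset.Icc 1 n, (1 - g i))) :=
        ENNReal.ofReal_le_ofReal <| sum_le_two_mul_one_sub_prod _
          (fun _ _ => capacityReal_nonneg _) (fun _ _ => capacityReal_le_one _) hhalf
    _ = 2 * S.capacity (jumpEvent p β c Xs n) := by
        rw [hprod, ENNReal.ofReal_mul two_pos.le, ENNReal.ofReal_ofNat]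

theorem tailSeries_lt_top_of_tsum_capacity_lt_top (h : S.IsIndepCopies X Xs) (hr : 1 < r)
    (hβ : 0 < β + p) (hC : 0 < C)
    (ha : ∀ᶠ n in Filter.atTop, ∀ i ∈ Finset.Icc 1 n, (jumpLevel p β n i)⁻¹ ≤ C * |a n i|)
    (hsum : ∀ ε : ℝ, 0 < ε →
      ∑' n : ℕ, ENNReal.ofReal ((n : ℝ) ^ (r - 2)) * S.capacity (maxSumEvent (a n) Xs ε n) < ⊤) :
    tailSeries r p β 1 (fun t => S.capacity {ω | t < |X ω|}) < ⊤ := by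
  have hhalf := (tendsto_capacity_jumpEvent hr hβ one_pos hC ha hsum).eventually_le_const
    (ENNReal.ofReal_pos.2 (by norm_num : (0 : ℝ) < 1 / 2))
  rw [tailSeries_eq_tsum]
  refine tsum_lt_top_of_eventually_le (g := fun n => 2 * (ENNReal.ofReal ((n : ℝ) ^ (r - 2))
    * S.capacity (maxSumEvent (a n) Xs (1 / (2 * C)) n))) (fun n => ?_) ?_ ?_
  · exact ENNReal.mul_ne_top ENNReal.ofReal_ne_top <|
      ENNReal.sum_ne_top.2 fun _ _ => capacity_ne_top _
  · filter_upwards [ha, hhalf] with n hn hle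
    rw [mul_left_comm]
    gcongr
    refine (h.sum_tail_le_two_mul_capacity_jumpEvent hle).trans ?_
    gcongr
    exact capacity_mono (jumpEvent_subset_maxSumEvent zero_le_one hC hn)
  · rw [ENNReal.tsum_mul_left]
    exact ENNReal.mul_lt_top ENNReal.ofNat_lt_top (hsum _ (by positivity))

theorem exists_capacity_maxSumEvent_le_tail_add_rpow (h : S.IsIndepCopies X Xs)
    (hS : S.CountablySubadditive) (hK : S.HasTailDecay X K q) (hr : 0 < r) (hβ : 0 < β + p)
    (hq0 : 0 < q) (hq1 : q ≠ 1) (hq2 : q < 2) (hpq : 1 < p * q)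
    (hmean : 1 < q → ∀ b : ℝ, S.E (fun ω => b * X ω) = 0) (hC : 0 < C)
    (ha : ∀ᶠ n in Filter.atTop, ∀ i ∈ Finset.Icc 1 n, |a n i| ≤ C * (jumpLevel p β n i)⁻¹)
    (hε : 0 < ε) :
    ∃ c : ℝ, 0 < c ∧ ∃ A : ℝ, 0 ≤ A ∧ ∀ᶠ n : ℕ in Filter.atTop,
      S.capacity (maxSumEvent (a n) Xs ε n)
        ≤ ∑ i ∈ Finset.Icc 1 n, S.capacity {ω | c * jumpLevel p β n i < |X ω|}
          + ENNReal.ofReal (A * (n : ℝ) ^ (-r)) := by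
  obtain ⟨η, hη, B, hB, hweights⟩ := exists_sum_inv_jumpLevel_rpow_le hβ hq0 hpq
  have hδ : 0 < η * ε / (2 * r) := by positivity
  obtain ⟨D, hD, hmax⟩ := h.exists_capacity_maxSumEvent_le hS hK hq1 hq2 hmean hδ
  obtain ⟨A, hA, hexp⟩ :=
    exists_chernoff_le_rpow hr hε hη (by positivity : 0 ≤ D * (C ^ q * B))
  refine ⟨η * ε / (2 * r) / C, by positivity, 2 * A, by positivity, ?_⟩
  filter_upwards [ha, Filter.eventually_ge_atTop 2] with n hn hn2
  have hn1 : (1 : ℝ) < n := by exact_mod_cast hn2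
  have hsum : ∑ i ∈ Finset.Icc 1 n, |a n i| ^ q ≤ C ^ q * B * (n : ℝ) ^ (-η) :=
    calc ∑ i ∈ Finset.Icc 1 n, |a n i| ^ q
        ≤ C ^ q * ∑ i ∈ Finset.Icc 1 n, ((jumpLevel p β n i)⁻¹) ^ q :=
          sum_abs_rpow_le hC.le hq0.le
            (fun i _ => inv_nonneg.2 (jumpLevel_nonneg p β n i)) hn
      _ ≤ C ^ q * (B * (n : ℝ) ^ (-η)) := by
          gcongr
          exact hweights n (one_le_two.trans hn2)
      _ = C ^ q * B * (n : ℝ) ^ (-η) := by ring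
  refine (hmax (a n) n (r / ε * Real.log n) ε
    (mul_pos (by positivity) (Real.log_pos hn1))).trans (add_le_add ?_ ?_)
  · refine Finset.sum_le_sum fun i hi => capacity_mono fun ω hω => ?_
    have hJ := jumpLevel_pos (p := p) (β := β) (one_le_two.trans hn2) (Finset.mem_Icc.1 hi).1
    simp only [Set.mem_ofPred_eq, abs_mul] at hω ⊢
    rw [div_mul_eq_mul_div, div_lt_iff₀ hC, ← lt_div_iff₀ hJ]
    calc η * ε / (2 * r) < |a n i| * |X ω| := hω
      _ ≤ C * (jumpLevel p β n i)⁻¹ * |X ω| := by gcongr; exact hn i hi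
      _ = |X ω| * C / jumpLevel p β n i := by ring
  · rw [mul_assoc 2 A, ENNReal.ofReal_mul two_pos.le, ENNReal.ofReal_ofNat]
    gcongr
    refine hexp n _ hn1.le ?_
    rw [mul_assoc D]
    gcongr

theorem tsum_capacity_maxSumEvent_lt_top (h : S.IsIndepCopies X Xs)
    (hS : S.CountablySubadditive) (hK : S.HasTailDecay X K q) (hr : 0 < r) (hβ : 0 < β + p)
    (hq0 : 0 < q) (hq1 : q ≠ 1) (hq2 : q < 2) (hpq : 1 < p * q)
    (hmean : 1 < q → ∀ b : ℝ, S.E (fun ω => b * X ω) = 0) (hC : 0 < C)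
    (ha : ∀ᶠ n in Filter.atTop, ∀ i ∈ Finset.Icc 1 n, |a n i| ≤ C * (jumpLevel p β n i)⁻¹)
    (htail : ∀ c : ℝ, 0 < c → tailSeries r p β c (fun t => S.capacity {ω | t < |X ω|}) < ⊤)
    (hε : 0 < ε) :
    ∑' n : ℕ, ENNReal.ofReal ((n : ℝ) ^ (r - 2)) * S.capacity (maxSumEvent (a n) Xs ε n) < ⊤ := by
  obtain ⟨c, hc, A, hA, hle⟩ := h.exists_capacity_maxSumEvent_le_tail_add_rpow hS hK hr hβ hq0 hq1
    hq2 hpq hmean hC ha hε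
  refine tsum_lt_top_of_eventually_le (g := fun n => ENNReal.ofReal ((n : ℝ) ^ (r - 2))
      * ∑ i ∈ Finset.Icc 1 n, S.capacity {ω | c * jumpLevel p β n i < |X ω|}
    + ENNReal.ofReal (A * (n : ℝ) ^ (-2 : ℝ)))
    (fun n => ENNReal.mul_ne_top ENNReal.ofReal_ne_top (capacity_ne_top _)) ?_ ?_
  · filter_upwards [hle, Filter.eventually_gt_atTop 0] with n hn hn0
    have hn0' : (0 : ℝ) < n := by exact_mod_cast hn0
    calc ENNReal.ofReal ((n : ℝ) ^ (r - 2)) * S.capacity (maxSumEvent (a n) Xs ε n)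
        ≤ ENNReal.ofReal ((n : ℝ) ^ (r - 2))
            * (∑ i ∈ Finset.Icc 1 n, S.capacity {ω | c * jumpLevel p β n i < |X ω|}
              + ENNReal.ofReal (A * (n : ℝ) ^ (-r))) := by gcongr
      _ = _ := by
          rw [mul_add, ← ENNReal.ofReal_mul (by positivity), mul_left_comm,
            ← Real.rpow_add hn0']
          ring_nf
  · have hpow : Summable fun n : ℕ => A * (n : ℝ) ^ (-2 : ℝ) :=
      (Real.summable_nat_rpow.2 (by norm_num)).mul_left A
    rw [ENNReal.tsum_add, ← tailSeries_eq_tsum r p β c fun t => S.capacity {ω | t < |X ω|},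
      ← ENNReal.ofReal_tsum_of_nonneg (fun n => by positivity) hpow]
    exact ENNReal.add_lt_top.2 ⟨htail c hc, ENNReal.ofReal_lt_top⟩

end IsIndepCopies

end SublinearExpectationSpace

theorem exists_tail_exponent {r p : ℝ} (hr : 1 < r) (hp : 1 / 2 < p) :
    ∃ q : ℝ, 0 < q ∧ 1 < p * q ∧ q ≤ r / p ∧ q < 2 ∧ q ≠ 1 ∧ (1 < q → p ≤ 1) := by
  have hp0 : 0 < p := by linarith
  have hrp : 1 / p < r / p := by gcongr
  rcases lt_or_ge 1 p with hp1 | hp1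
  · obtain ⟨q, hpq, hq⟩ := exists_between (lt_min ((div_lt_one hp0).2 hp1) hrp)
    obtain ⟨hq1, hqr⟩ := lt_min_iff.1 hq
    exact ⟨q, (by positivity : 0 < 1 / p).trans hpq, (div_lt_iff₀' hp0).1 hpq, hqr.le,
      hq1.trans one_lt_two, hq1.ne, fun h => absurd h hq1.not_gt⟩
  · have hp2 : 1 / p < 2 := by
      rw [div_lt_iff₀ hp0]
      linarith
    obtain ⟨q, hpq, hq⟩ := exists_between (lt_min hp2 hrp)
    obtain ⟨hq2, hqr⟩ := lt_min_iff.1 hq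
    exact ⟨q, (by positivity : 0 < 1 / p).trans hpq, (div_lt_iff₀' hp0).1 hpq, hqr.le, hq2,
      (((one_le_div hp0).2 hp1).trans_lt hpq).ne', fun _ => hp1⟩

/-- A function `f` whose Choquet moment `C_V(f |X|)` decides complete convergence for the weights
`(i / n) ^ β * (1 / n) ^ p`: besides having the right order of growth, it controls `t ^ (r / p)`. -/
structure IsMomentGauge (r p β : ℝ) (f : ℝ → ℝ) : Prop
    extends IsIncreasingHomeo f, GrowthComparable r p β f where
  mul_rpow_le : ∃ c : ℝ, 0 < c ∧ ∀ t, 1 ≤ t → c * t ^ (r / p) ≤ f t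

namespace IsMomentGauge

variable {r p β : ℝ}

theorem rpow_of_lt (hr : 1 < r) (hp : 0 < p) (hβ : 0 < β + p) (h : β < -p / r) :
    IsMomentGauge r p β fun x => x ^ ((r - 1) / (p + β)) where
  toIsIncreasingHomeo := .rpow (div_pos (by linarith) (by linarith))
  toGrowthComparable := growthComparable_rpow_of_lt hr hp hβ h
  mul_rpow_le := ⟨1, one_pos, fun t ht => by
    have hexp : r / p ≤ (r - 1) / (p + β) := by
      rw [lt_div_iff₀ (by linarith)] at h
      rw [div_le_div_iff₀ hp (by linarith)]
      linarith
    rw [one_mul]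
    gcongr⟩

theorem rpow_mul_log_of_eq (hr : 1 < r) (hp : 0 < p) (h : β = -p / r) :
    IsMomentGauge r p β fun x => x ^ (r / p) * Real.log (1 + x) where
  toIsIncreasingHomeo := (IsIncreasingHomeo.rpow (by positivity)).mul .log_one_add
  toGrowthComparable := growthComparable_rpow_mul_log hr hp h
  mul_rpow_le := ⟨Real.log 2, Real.log_pos one_lt_two, fun t ht => by
    rw [mul_comm]
    gcongr
    linarith⟩

theorem rpow_of_gt (hr : 1 < r) (hp : 0 < p) (hβ : 0 < β + p) (h : -p / r < β) :
    IsMomentGauge r p β fun x => x ^ (r / p) where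
  toIsIncreasingHomeo := .rpow (by positivity)
  toGrowthComparable := growthComparable_rpow_of_gt hr hp hβ h
  mul_rpow_le := ⟨1, one_pos, fun _ _ => (one_mul _).le⟩

end IsMomentGauge

namespace SublinearExpectationSpace

variable {Ω : Type*} [MeasurableSpace Ω] {S : SublinearExpectationSpace Ω}

theorem tsum_maxWeightedSum_lt_top_iff (r ε : ℝ) (a : ℕ → ℕ → ℝ) (Xs : ℕ → Ω → ℝ) :
    ∑' n : ℕ+, ENNReal.ofReal ((n : ℝ) ^ (r - 2)) * S.capacity {ω | ε < maxWeightedSum a Xs n ω} < ⊤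
      ↔ ∑' n : ℕ, ENNReal.ofReal ((n : ℝ) ^ (r - 2)) * S.capacity (maxSumEvent (a n) Xs ε n)
        < ⊤ := by
  simp only [lt_maxWeightedSum_iff]
  exact tsum_pnat_lt_top_iff
    (f := fun n => ENNReal.ofReal ((n : ℝ) ^ (r - 2)) * S.capacity (maxSumEvent (a n) Xs ε n))
    (ENNReal.mul_lt_top ENNReal.ofReal_lt_top (capacity_ne_top _).lt_top)

theorem IsIndepCopies.choquet_lt_top_iff_tsum_capacity {X : Ω → ℝ} {Xs : ℕ → Ω → ℝ}
    (h : S.IsIndepCopies X Xs) (hS : S.CountablySubadditive) {r p β : ℝ} (hr : 1 < r)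
    (hp : 1 / 2 < p) (hβ : 0 < β + p)
    (hmean : p ≤ 1 → S.E X = 0 ∧ S.E (fun ω => -X ω) = 0) {a : ℕ → ℕ → ℝ}
    (ha : ArrayApprox a (fun n i => ((i : ℝ) / (n : ℝ)) ^ β * (1 / (n : ℝ)) ^ p)) {f : ℝ → ℝ}
    (hf : IsMomentGauge r p β f) :
    S.choquet (fun ω => f |X ω|) < ⊤ ↔ ∀ ε : ℝ, 0 < ε →
      ∑' n : ℕ, ENNReal.ofReal ((n : ℝ) ^ (r - 2)) * S.capacity (maxSumEvent (a n) Xs ε n)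
        < ⊤ := by
  have hp0 : 0 < p := by linarith
  obtain ⟨C, hC, hbounds⟩ := ha.exists_abs_bounds
  have hchoquet := fun c hc => choquet_comp_abs_lt_top_iff hr hp0 hβ hf.toIsIncreasingHomeo
    hf.toGrowthComparable (c := c) hc (S := S) X
  constructor
  · intro hX ε hε
    obtain ⟨q, hq0, hpq, hqr, hq2, hq1, hqp⟩ := exists_tail_exponent hr hp
    obtain ⟨c, hc, hcf⟩ := hf.mul_rpow_le
    obtain ⟨K, hK⟩ := exists_hasTailDecay_of_choquet_lt_top hf.toIsIncreasingHomeo hc hq0.le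
      (fun t ht => le_trans (by gcongr) (hcf t ht)) hX
    refine h.tsum_capacity_maxSumEvent_lt_top hS hK (by linarith) hβ hq0 hq1 hq2 hpq
      (fun hq b => ?_) hC (hbounds.mono fun n hn i hi => (hn i hi).1)
      (fun c hc => (hchoquet c hc).1 hX) hε
    exact E_const_mul_eq_zero h.mem (hmean (hqp hq)).1 (hmean (hqp hq)).2 b
  · exact fun hsum => (hchoquet 1 one_pos).2 <| h.tailSeries_lt_top_of_tsum_capacity_lt_top hr hβ hC
      (hbounds.mono fun n hn i hi => (hn i hi).2) hsum

end SublinearExpectationSpace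

theorem theorem3p1 {Ω : Type*} [MeasurableSpace Ω] (S : SublinearExpectationSpace Ω)
    (hS : S.CountablySubadditive)
    (X : Ω → ℝ) (hX : X ∈ S.H)
    (Xs : ℕ → Ω → ℝ) (hXs : ∀ n, 1 ≤ n → Xs n ∈ S.H)
    (hindep : S.IndepSeq Xs)
    (hident : ∀ n, 1 ≤ n →
      SublinearExpectationSpace.IdentDistributed S S
        (fun _ : Fin 1 => Xs n) (fun _ : Fin 1 => X))
    (r p β : ℝ) (hr : 1 < r) (hp : 1 / 2 < p) (hβ : 0 < β + p)
    (hmean : p ≤ 1 → S.E X = 0 ∧ -S.E (fun ω => -X ω) = 0)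
    (a : ℕ → ℕ → ℝ)
    (ha : ArrayApprox a (fun n i => ((i : ℝ) / (n : ℝ)) ^ β * (1 / (n : ℝ)) ^ p)) :
    ((-p < β → β < -p / r → S.choquet (fun ω => |X ω| ^ ((r - 1) / (p + β))) < ⊤) ∧
      (β = -p / r → S.choquet (fun ω => |X ω| ^ (r / p) * Real.log (1 + |X ω|)) < ⊤) ∧
      (-p / r < β → S.choquet (fun ω => |X ω| ^ (r / p)) < ⊤)) ↔
    (∀ ε : ℝ, 0 < ε →
      ∑' n : ℕ+, ENNReal.ofReal ((n : ℝ) ^ (r - 2)) *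
        S.capacity {ω | ε < maxWeightedSum a Xs n ω} < ⊤) := by
  have h := SublinearExpectationSpace.IsIndepCopies.mk hX hXs hindep hident
  have hmean' : p ≤ 1 → S.E X = 0 ∧ S.E (fun ω => -X ω) = 0 := fun hp1 =>
    (hmean hp1).imp_right EReal.neg_eq_zero_iff.1
  have hgauge := fun {f} (hf : IsMomentGauge r p β f) =>
    h.choquet_lt_top_iff_tsum_capacity hS hr hp hβ hmean' ha hf
  have hp0 : 0 < p := by linarith
  simp only [S.tsum_maxWeightedSum_lt_top_iff]
  rcases lt_trichotomy β (-p / r) with hlt | heq | hgt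
  · rw [← hgauge (.rpow_of_lt hr hp0 hβ hlt)]
    exact ⟨fun H => H.1 (by linarith) hlt, fun H =>
      ⟨fun _ _ => H, fun heq => absurd heq hlt.ne, fun hgt => absurd hgt hlt.not_gt⟩⟩
  · rw [← hgauge (.rpow_mul_log_of_eq hr hp0 heq)]
    exact ⟨fun H => H.2.1 heq, fun H =>
      ⟨fun _ hlt => absurd heq hlt.ne, fun _ => H, fun hgt => absurd heq hgt.ne'⟩⟩
  · rw [← hgauge (.rpow_of_gt hr hp0 hβ hgt)]
    exact ⟨fun H => H.2.2 hgt, fun H =>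
      ⟨fun _ hlt => absurd hlt hgt.not_gt, fun heq => absurd heq hgt.ne', fun _ => H⟩⟩
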